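/- \textbf{Definitions.} A \emph{gliding system} in a group $G$ is a set $\mathcal G\subset G\setminus\{1\}$ of \emph{glides}, closed under inversion, with a symmetric relation of \emph{independence} on $\mathcal G$ such that independent glides commute, independence of $s,t$ implies independence of $s^{-1},t$, and no glide is independent of itself. For a finite set $S$ of pairwise independent glides put $[S]=\prod_{s\in S}s$; $S$ is \emph{cubic} if $[T_1]\neq[T_2]$ for all distinct $T_1,T_2\subset S$. A \emph{based cube} is a pair $(A,S)$ with $A\in G$ and $S$ cubic; its \emph{vertices} are the elements $[T]A$, $T\subset S$. For $T\subset S$ put $S_T=(S\setminus T)\cup\{t^{-1}\}_{t\in T}$. A \emph{cube} in $G$ is a class of based cubes under the equivalence relation identifying $(A,S)$ with $([T]A,S_T)$ for $T\subset S$. A cube $Q$ is a \emph{face} of a cube $Q'$ if they are represented by based cubes $(A,S)$ and $(A,S')$ with $S\subset S'$. For $\mathcal E\subset G$, a \emph{cube in $\mathcal E$} is a cube whose vertices all lie in $\mathcal E$. A \emph{hull} of $J\subset\mathcal E$ in $\mathcal E$ is a cube in $\mathcal E$ whose vertices include $J$ and which is a face of every cube in $\mathcal E$ whose vertices include $J$.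 The \emph{glide complex} $X_{\mathcal E}$ is the quotient of the disjoint union of the cubes $[0,1]^S$ over all based cubes $(A,S)$ with vertices in $\mathcal E$ by the equivalence relation generated by: $(A,S,x)\sim(A,S',x')$ if $S\subset S'$, $x=x'|_S$ and $x'=0$ on $S'\setminus S$; and $(A,S,x)\sim([T]A,S_T,x')$ if $T\subset S$, $x'=x$ on $S\setminus T$ and $x'(t^{-1})=1-x(t)$ for $t\in T$. Its $0$-cells are the elements of $\mathcal E$. The groupoid $\pi_1(X_{\mathcal E},\mathcal E)$ has the set of objects $\mathcal E$, its morphisms $A\to B$ are the homotopy classes (relative to the endpoints) of paths from $A$ to $B$ in $X_{\mathcal E}$, and the composition $fg$ is $f$ followed by $g$. Let $\Gamma$ be a finite graph without loops, possibly with multiple edges, and let $E$ be its set of edges. The power group $2^E$, with product $AB=(A\cup B)\setminus(A\cap B)$, carries the gliding system whose glides are the even cycles of $\Gamma$ (sets of an even number of edges whose union is a single embedded circle), two of them being independent if they have no common vertices. A \emph{dimer covering} of $\Gamma$ is a set $A\subset E$ such that every vertex $v$ is incident to exactly one edge $A_v$ in $A$. Let $\mathcal D\subset 2^E$ be the set of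 dimer coverings. A triple $A,B,C\in\mathcal D$ is \emph{flat} if for every vertex $v$ at least two of the edges $A_v,B_v,C_v$ are equal. Triples below need not consist of distinct elements. \textbf{Theorem.} (1) Let $G$ be a group with a gliding system and let $\mathcal E\subset G$ be a set such that every $2$-element subset of $\mathcal E$ has a hull in $\mathcal E$. Then the groupoid $\pi_1(X_{\mathcal E},\mathcal E)$ is presented by generators $z_{A,B}:A\to B$, one for each ordered pair $A,B\in\mathcal E$, and the defining relations $z_{A,C}=z_{A,B}\,z_{B,C}$ for each triple $A,B,C$ of vertices of a cube in $\mathcal E$. The image of $z_{A,B}$ in $\pi_1(X_{\mathcal E},\mathcal E)$ is represented by any path from $A$ to $B$ in the hull of $\{A,B\}$, and such a path exists. (2) For every finite graph $\Gamma$ without loops, the dimer groupoid $\pi_1(X_{\mathcal D},\mathcal D)$ is presented by generators $z_{A,B}:A\to B$, one for each ordered pair $A,B\in\mathcal D$, and the defining relations $z_{A,C}=z_{A,B}\,z_{B,C}$ for every flat triple $A,B,C\in\mathcal D$. Every set $\{A,B\}\subset\mathcal D$ has a hull in $\mathcal D$, and the image of $z_{A,B}$ is represented by any path from $A$ to $B$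 in the hull of $\{A,B\}$; such a path exists. -/

import Mathlib

noncomputable section

open CategoryTheory

/-! ### Gliding systems, cubes, hulls -/

/-- A gliding system in a group `G`: a set of glides and a relation of independence between
glides. -/
structure GlidingSystem (G : Type*) [Group G] where
  glides : Set G
  Indep : G → G → Prop
  one_notMem : (1 : G) ∉ glides
  glide_of_indep : ∀ {s t : G}, Indep s t → s ∈ glides ∧ t ∈ glides
  inv_mem : ∀ {s : G}, s ∈ glides → s⁻¹ ∈ glides
  comm : ∀ {s t : G}, Indep s t → s * t = t * s
  inv_left : ∀ {s t : G}, Indep s t → Indep s⁻¹ t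
  symm : ∀ {s t : G}, Indep s t → Indep t s
  irrefl : ∀ s : G, s ∈ glides → ¬ Indep s s

namespace GlidingSystem

variable {G : Type*} [Group G] (𝒢 : GlidingSystem G)

/-- A finite set of pairwise independent glides. -/
def IsIndepSet (S : Finset G) : Prop :=
  (∀ s ∈ S, s ∈ 𝒢.glides) ∧ (S : Set G).Pairwise 𝒢.Indep

variable {𝒢}

theorem IsIndepSet.subset {S T : Finset G} (hS : 𝒢.IsIndepSet S) (h : T ⊆ S) :
    𝒢.IsIndepSet T :=
  ⟨fun s hs => hS.1 s (h hs), hS.2.mono (by exact_mod_cast h)⟩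

/-- The element `[S] = ∏_{s ∈ S} s` of `G`, for a finite set `S` of independent glides. -/
def bracket (S : Finset G) (hS : 𝒢.IsIndepSet S) : G :=
  S.noncommProd id fun _ hs _ ht hst => 𝒢.comm (hS.2 hs ht hst)

variable (𝒢)

/-- A cubic set of glides: a finite set `S` of pairwise independent glides such that
`[T₁] ≠ [T₂]` for all distinct `T₁, T₂ ⊆ S`. -/
def IsCubic (S : Finset G) : Prop :=
  ∃ hS : 𝒢.IsIndepSet S, ∀ (T₁ T₂ : Finset G) (h₁ : T₁ ⊆ S) (h₂ : T₂ ⊆ S),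
    bracket T₁ (hS.subset h₁) = bracket T₂ (hS.subset h₂) → T₁ = T₂

theorem isCubic_empty : 𝒢.IsCubic ∅ :=
  ⟨⟨by simp, by simp⟩, fun T₁ T₂ h₁ h₂ _ => by
    rw [Finset.subset_empty.1 h₁, Finset.subset_empty.1 h₂]⟩

/-- A based cube `(A, S)`: an element `A` of `G` and a cubic set `S` of glides. -/
structure BasedCube where
  base : G
  dirs : Finset G
  cubic : 𝒢.IsCubic dirs

variable {𝒢}

namespace BasedCube

/-- The vertex `[T]A` of the based cube `(A, S)`, for `T ⊆ S`. -/
def vertex (q : 𝒢.BasedCube) (T : Finset G) (hT : T ⊆ q.dirs) : G :=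
  bracket T (q.cubic.choose.subset hT) * q.base

/-- The set of vertices of a based cube. -/
def vertices (q : 𝒢.BasedCube) : Set G :=
  {A | ∃ (T : Finset G) (hT : T ⊆ q.dirs), A = q.vertex T hT}

open Classical in
/-- The set `S_T = (S \ T) ∪ {t⁻¹ | t ∈ T}`. -/
def flipDirs (S T : Finset G) : Finset G :=
  (S \ T) ∪ T.image fun t => t⁻¹

/-- `(A', S')` is obtained from `(A, S)` by flipping along `T ⊆ S`:
`A' = [T]A` and `S' = S_T`. -/
def IsFlip (q q' : 𝒢.BasedCube) (T : Finset G) : Prop :=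
  ∃ hT : T ⊆ q.dirs, q'.base = q.vertex T hT ∧ q'.dirs = flipDirs q.dirs T

end BasedCube

variable (𝒢)

/-- A cube in `G`: a class of based cubes, where `(A, S)` and `([T]A, S_T)` are identified for
all `T ⊆ S`. -/
def Cube : Type _ :=
  Quot fun q q' : 𝒢.BasedCube => ∃ T, q.IsFlip q' T

variable {𝒢}

/-- The cube represented by a based cube. -/
def BasedCube.toCube (q : 𝒢.BasedCube) : 𝒢.Cube :=
  Quot.mk _ q

namespace Cube

/-- The vertices of a cube are those of the based cubes that represent it. -/
def vertices (Q : 𝒢.Cube) : Set G :=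
  {A | ∃ q : 𝒢.BasedCube, q.toCube = Q ∧ A ∈ q.vertices}

/-- `Q` is a face of `Q'` if they are represented by `(A, S)` and `(A, S')` with `S ⊆ S'`. -/
def IsFace (Q Q' : 𝒢.Cube) : Prop :=
  ∃ q q' : 𝒢.BasedCube,
    q.toCube = Q ∧ q'.toCube = Q' ∧ q.base = q'.base ∧ q.dirs ⊆ q'.dirs

/-- `Q` is a cube in `ℰ` if its vertices lie in `ℰ`. -/
def IsIn (Q : 𝒢.Cube) (ℰ : Set G) : Prop :=
  Q.vertices ⊆ ℰ

/-- `Q` is the hull of `J` in `ℰ`: it is a cube in `ℰ` having all elements of `J` among its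
vertices, and it is a face of every cube in `ℰ` having this property. -/
def IsHull (ℰ J : Set G) (Q : 𝒢.Cube) : Prop :=
  Q.IsIn ℰ ∧ J ⊆ Q.vertices ∧
    ∀ Q' : 𝒢.Cube, Q'.IsIn ℰ → J ⊆ Q'.vertices → Q.IsFace Q'

end Cube

/-! ### The glide complex -/

variable (𝒢) (ℰ : Set G)

/-- The disjoint union of the geometric cubes `I^S` over all based cubes `(A, S)` whose vertices
lie in `ℰ`; its points are the triples `(A, S, x)` with `x : S → I`. -/
abbrev CubePoint : Type _ :=
  Σ q : {q : 𝒢.BasedCube // q.vertices ⊆ ℰ}, ({s : G // s ∈ q.1.dirs} → unitInterval)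

variable {𝒢 ℰ}

/-- The elementary identification of a point of a face: `A = A'`, `S ⊆ S'`, `x = x'` on `S`,
and `x' = 0` on `S' \ S`. -/
def CubePoint.FaceRel (p p' : 𝒢.CubePoint ℰ) : Prop :=
  p.1.1.base = p'.1.1.base ∧ p.1.1.dirs ⊆ p'.1.1.dirs ∧
    (∀ (s : G) (h : s ∈ p.1.1.dirs) (h' : s ∈ p'.1.1.dirs), p.2 ⟨s, h⟩ = p'.2 ⟨s, h'⟩) ∧
    ∀ (s : G) (h' : s ∈ p'.1.1.dirs), s ∉ p.1.1.dirs → p'.2 ⟨s, h'⟩ = 0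

/-- The elementary identification under a flip: `A' = [T]A`, `S' = S_T`, `x' = x` on `S \ T`,
and `x'(t⁻¹) = 1 - x(t)` for `t ∈ T`. -/
def CubePoint.FlipRel (p p' : 𝒢.CubePoint ℰ) : Prop :=
  ∃ T : Finset G, p.1.1.IsFlip p'.1.1 T ∧
    (∀ (s : G) (h : s ∈ p.1.1.dirs) (h' : s ∈ p'.1.1.dirs), s ∉ T →
      p'.2 ⟨s, h'⟩ = p.2 ⟨s, h⟩) ∧
    ∀ t ∈ T, ∀ (h : t ∈ p.1.1.dirs) (h' : t⁻¹ ∈ p'.1.1.dirs),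
      p'.2 ⟨t⁻¹, h'⟩ = unitInterval.symm (p.2 ⟨t, h⟩)

variable (𝒢 ℰ)

/-- The glide complex `X_ℰ`: the cubed complex glued, with the quotient topology, from the cubes
in `ℰ` (`X_G` is the case `ℰ = Set.univ`). -/
def GlideComplex : Type _ :=
  Quot fun p p' : 𝒢.CubePoint ℰ => p.FaceRel p' ∨ p.FlipRel p'

instance : TopologicalSpace (𝒢.GlideComplex ℰ) :=
  inferInstanceAs (TopologicalSpace (Quot _))

variable {𝒢 ℰ}

/-- The point of `X_ℰ` represented by a triple `(A, S, x)`. -/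
def GlideComplex.point (p : 𝒢.CubePoint ℰ) : 𝒢.GlideComplex ℰ :=
  Quot.mk _ p

variable (𝒢)

theorem vertices_empty_subset (A : ℰ) :
    (⟨A, ∅, 𝒢.isCubic_empty⟩ : 𝒢.BasedCube).vertices ⊆ ℰ := by
  rintro B ⟨T, hT, rfl⟩
  obtain rfl := Finset.subset_empty.1 hT
  have h : (∅ : Finset G).noncommProd id (by simp) * (A : G) ∈ ℰ := by
    rw [Finset.noncommProd_empty, one_mul]
    exact A.2
  exact h

/-- The `0`-cell of `X_ℰ` given by `A ∈ ℰ`. -/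
def zeroCell (A : ℰ) : 𝒢.GlideComplex ℰ :=
  GlideComplex.point ⟨⟨⟨A, ∅, 𝒢.isCubic_empty⟩, 𝒢.vertices_empty_subset A⟩,
    fun s => absurd s.2 (Finset.notMem_empty _)⟩

variable {𝒢}

/-- The closed cell of `X_ℰ` given by a cube `Q` in `ℰ`. -/
def Cube.cell (ℰ : Set G) (Q : 𝒢.Cube) : Set (𝒢.GlideComplex ℰ) :=
  {a | ∃ p : 𝒢.CubePoint ℰ, p.1.1.toCube = Q ∧ GlideComplex.point p = a}

variable (𝒢 ℰ)

/-- The groupoid `π₁(X_ℰ, ℰ)`: the full subgroupoid of the fundamental groupoid of `X_ℰ` on the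
set `ℰ` of `0`-cells. A composition `f ≫ g` is `f` followed by `g`. -/
abbrev FundGroupoid : Type _ :=
  InducedCategory (FundamentalGroupoid (𝒢.GlideComplex ℰ))
    fun A : ℰ => (⟨𝒢.zeroCell A⟩ : FundamentalGroupoid (𝒢.GlideComplex ℰ))

variable {𝒢 ℰ}

/-- The element `A` of `ℰ` as an object of `π₁(X_ℰ, ℰ)`. -/
def obj (A : ℰ) : 𝒢.FundGroupoid ℰ := A

/-- The morphism of `π₁(X_ℰ, ℰ)` represented by a path. -/
def pathClass {A B : ℰ} (γ : Path (𝒢.zeroCell A) (𝒢.zeroCell B)) :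
    (obj A : 𝒢.FundGroupoid ℰ) ⟶ obj B :=
  InducedCategory.homMk (Path.Homotopic.Quotient.mk γ)

variable (𝒢 ℰ)

/-- `A, B, C ∈ ℰ` are (not necessarily distinct) vertices of a cube in `ℰ`. -/
def InCommonCube (A B C : ℰ) : Prop :=
  ∃ Q : 𝒢.Cube, Q.IsIn ℰ ∧ (A : G) ∈ Q.vertices ∧ (B : G) ∈ Q.vertices ∧ (C : G) ∈ Q.vertices

end GlidingSystem

/-! ### The groupoid presented by triangle relations -/

/-- The quiver on `V` with exactly one arrow `A ⟶ B` for every ordered pair `(A, B)`. -/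
structure PairQuiver (V : Type*) where
  as : V

instance (V : Type*) : Quiver.{0} (PairQuiver V) := ⟨fun _ _ => Unit⟩

namespace TriangleGroupoid

variable {V : Type*} (R : V → V → V → Prop)

/-- The free generator `A ⟶ B` of the free groupoid on `PairQuiver V`. -/
def freeGen (A B : V) :
    (Quiver.FreeGroupoid.of (PairQuiver V)).obj ⟨A⟩ ⟶
      (Quiver.FreeGroupoid.of (PairQuiver V)).obj ⟨B⟩ :=
  (Quiver.FreeGroupoid.of (PairQuiver V)).map (X := ⟨A⟩) (Y := ⟨B⟩) ()

/-- The relations `z_{A,C} = z_{A,B} z_{B,C}` for the triples with `R A B C`. -/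
inductive Rel : HomRel (Quiver.FreeGroupoid (PairQuiver V))
  | triangle (A B C : V) (h : R A B C) : Rel (freeGen A C) (freeGen A B ≫ freeGen B C)

end TriangleGroupoid

/-- The groupoid with set of objects `V` presented by generators `z_{A,B} : A ⟶ B` for all
`A, B` in `V` and relations `z_{A,C} = z_{A,B} z_{B,C}` for all triples with `R A B C`. -/
abbrev TriangleGroupoid {V : Type*} (R : V → V → V → Prop) : Type _ :=
  CategoryTheory.Quotient (TriangleGroupoid.Rel R)

namespace TriangleGroupoid

variable {V : Type*} (R : V → V → V → Prop)

/-- The object of the presented groupoid given by an element of `V`. -/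
def obj (A : V) : TriangleGroupoid R :=
  (CategoryTheory.Quotient.functor _).obj ((Quiver.FreeGroupoid.of (PairQuiver V)).obj ⟨A⟩)

/-- The generator `z_{A,B}` of the presented groupoid. -/
def gen (A B : V) : obj R A ⟶ obj R B :=
  (CategoryTheory.Quotient.functor _).map (freeGen A B)

variable {R} {C : Type*} [Groupoid C]

/-- The prefunctor from `PairQuiver V` given by a family of morphisms. -/
def prefunctor (F : V → C) (z : ∀ A B : V, F A ⟶ F B) : PairQuiver V ⥤q C where
  obj A := F A.as
  map {A B} _ := z A.as B.as

theorem lift_freeGen (F : V → C) (z : ∀ A B : V, F A ⟶ F B) (A B : V) :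
    (Quiver.FreeGroupoid.lift (prefunctor F z)).map (freeGen A B) = z A B :=
  Category.id_comp (z A B)

/-- The functor from the presented groupoid that carries the generators to given morphisms
satisfying the relations. -/
def lift (F : V → C) (z : ∀ A B : V, F A ⟶ F B)
    (hz : ∀ A B D : V, R A B D → z A D = z A B ≫ z B D) : TriangleGroupoid R ⥤ C :=
  CategoryTheory.Quotient.lift _ (Quiver.FreeGroupoid.lift (prefunctor F z)) (by
    rintro _ _ _ _ ⟨A, B, D, h⟩
    rw [Functor.map_comp, lift_freeGen, lift_freeGen, lift_freeGen]
    exact hz A B D h)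

theorem lift_obj (F : V → C) (z : ∀ A B : V, F A ⟶ F B)
    (hz : ∀ A B D : V, R A B D → z A D = z A B ≫ z B D) (A : V) :
    (lift F z hz).obj (obj R A) = F A := rfl

theorem lift_gen (F : V → C) (z : ∀ A B : V, F A ⟶ F B)
    (hz : ∀ A B D : V, R A B D → z A D = z A B ≫ z B D) (A B : V) :
    (lift F z hz).map (gen R A B) = z A B :=
  lift_freeGen F z A B

end TriangleGroupoid

namespace GlidingSystem

variable {G : Type*} [Group G] (𝒢 : GlidingSystem G) (ℰ : Set G)

/-- The groupoid `π₁(X_ℰ, ℰ)` is presented by generators `z_{A,B} : A ⟶ B`, for `A, B ∈ ℰ`, and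
relations `z_{A,C} = z_{A,B} z_{B,C}` for the triples with `R A B C`, where the image of `z_{A,B}`
is represented by any path from `A` to `B` in the hull of `{A, B}` in `ℰ`.

That is, there are morphisms `z_{A,B}` represented in this way and satisfying the relations, such
that the resulting functor from the presented groupoid, which is the identity on objects, is
bijective on morphisms. -/
def IsPresentedBy (R : ℰ → ℰ → ℰ → Prop) : Prop :=
  ∃ (z : ∀ A B : ℰ, (obj A : 𝒢.FundGroupoid ℰ) ⟶ obj B)
    (hz : ∀ A B C : ℰ, R A B C → z A C = z A B ≫ z B C),
    (∀ A B : ℰ, ∃ Q : 𝒢.Cube, Q.IsHull ℰ {(A : G), (B : G)} ∧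
      (∃ γ : Path (𝒢.zeroCell A) (𝒢.zeroCell B), Set.range γ ⊆ Q.cell ℰ) ∧
      ∀ γ : Path (𝒢.zeroCell A) (𝒢.zeroCell B), Set.range γ ⊆ Q.cell ℰ →
        z A B = pathClass γ) ∧
    Function.Bijective (TriangleGroupoid.lift (R := R) obj z hz).obj ∧
    (TriangleGroupoid.lift (R := R) obj z hz).Full ∧
    (TriangleGroupoid.lift (R := R) obj z hz).Faithful

end GlidingSystem

/-! ### Even cycles and dimer coverings in graphs -/

/-- The power group of `ι`: all subsets of `ι`, with the symmetric difference as product. -/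
def PowerGroup (ι : Type*) : Type _ := Set ι

instance (ι : Type*) : Membership ι (PowerGroup ι) :=
  inferInstanceAs (Membership ι (Set ι))

instance (ι : Type*) : CommGroup (PowerGroup ι) where
  mul A B := @symmDiff (Set ι) _ _ A B
  one := (∅ : Set ι)
  inv A := A
  mul_assoc := @symmDiff_assoc (Set ι) _
  one_mul := @bot_symmDiff (Set ι) _
  mul_one := @symmDiff_bot (Set ι) _
  inv_mul_cancel := @symmDiff_self (Set ι) _
  mul_comm := @symmDiff_comm (Set ι) _

namespace Graph

variable {α β : Type*} (Γ : Graph α β)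

/-- A finite set `s` of edges is cyclic if every vertex is incident to no edge of `s` or to
exactly two distinct edges of `s`. -/
def IsCyclicSet (s : Set E(Γ)) : Prop :=
  s.Finite ∧ ∀ v ∈ V(Γ), {e ∈ s | Γ.Inc e v} = ∅ ∨ {e ∈ s | Γ.Inc e v}.ncard = 2

/-- A cycle: a cyclic set of edges whose union is a single circle, that is, a cyclic set of edges
which is non-empty and connected. -/
def IsCycleSet (s : Set E(Γ)) : Prop :=
  Γ.IsCyclicSet s ∧ s.Nonempty ∧ ∀ e ∈ s, ∀ f ∈ s,
    Relation.ReflTransGen (fun e f => e ∈ s ∧ f ∈ s ∧ ∃ v, Γ.Inc e v ∧ Γ.Inc f v) e f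

/-- An even cycle: a cycle with an even number of edges. -/
def IsEvenCycle (s : Set E(Γ)) : Prop :=
  Γ.IsCycleSet s ∧ Even s.ncard

/-- The gliding system in the power group of the set of edges of a graph: the glides are the even
cycles, and two of them are independent if they have no common vertices. -/
def cycleGliding : GlidingSystem (PowerGroup E(Γ)) where
  glides := {s | Γ.IsEvenCycle s}
  Indep s t := Γ.IsEvenCycle s ∧ Γ.IsEvenCycle t ∧
    ∀ e ∈ s, ∀ f ∈ t, ¬ ∃ v, Γ.Inc e v ∧ Γ.Inc f v
  one_notMem h := Set.not_nonempty_empty h.1.2.1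
  glide_of_indep h := ⟨h.1, h.2.1⟩
  inv_mem h := h
  comm _ := mul_comm _ _
  inv_left h := h
  symm := fun ⟨hs, ht, h⟩ => ⟨ht, hs, fun e he f hf ⟨v, h₁, h₂⟩ => h f hf e he ⟨v, h₂, h₁⟩⟩
  irrefl s hs h := by
    obtain ⟨e, he⟩ := hs.1.2.1
    obtain ⟨x, y, hxy⟩ := (Γ.edge_mem_iff_exists_isLink e).1 e.2
    exact h.2.2 e he e he ⟨x, ⟨y, hxy⟩, ⟨y, hxy⟩⟩

/-- The set `𝒟` of dimer coverings (perfect matchings): sets `A` of edges such that every vertex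
is incident to exactly one edge in `A`. -/
def dimerCoverings : Set (PowerGroup E(Γ)) :=
  {A | ∀ v ∈ V(Γ), ∃! e : E(Γ), e ∈ A ∧ Γ.Inc e v}

variable {Γ}

/-- The only edge `A_v` of a dimer covering `A` incident to a vertex `v`. -/
def dimerAt (A : Γ.dimerCoverings) (v : α) (hv : v ∈ V(Γ)) : E(Γ) :=
  (A.2 v hv).choose

/-- A triple `A, B, C` of dimer coverings is flat if for every vertex `v` at least two of the
edges `A_v, B_v, C_v` are equal. -/
def IsFlat (A B C : Γ.dimerCoverings) : Prop :=
  ∀ (v : α) (hv : v ∈ V(Γ)),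
    dimerAt A v hv = dimerAt B v hv ∨ dimerAt A v hv = dimerAt C v hv ∨
      dimerAt B v hv = dimerAt C v hv

end Graph

end

/-! Part (1) is a van Kampen argument for the cover of `X_ℰ` by the open stars of its vertices. The
star of `A` consists of the points where the multilinear interpolation of the indicator of `A` is
positive: inside a cube with vertex `A`, the points off the faces opposite to `A`. It contracts to
`A` along straight rays. The stars of `A`, `B`, `C` meet only inside a cube having these three
vertices, so triple intersections yield only triangles that occur among the relations; any two stars
meet, since a hull exists. Connectedness of intersections is never used. Instead, a point `x` common
to the stars of `A` and `B` lies in a cube that has the hull of `{A, B}` as a face, and inside that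
cube the ray from `x` to `A` followed by a path in the hull is homotopic to the ray from `x` to `B`.
This uses that paths in a closed cell are determined by their endpoints up to homotopy
(`homotopic_of_range_subset`): the coordinates of a cube extend, again by interpolation, to the
whole complex, so every cell is a retract.

The topology is isolated in `RadialCover.full_and_faithful`. Fullness: a path is cut into pieces
lying in single stars, each piece is replaced by rays, and each change of star contributes a
generator. Faithfulness: trivial coverings of the stars are glued into a covering of `X`, with fibre
the automorphism group of an object of the presented groupoid and with the generators as transition
functions; the relations are the cocycle condition. The monodromy along the image of a morphism `f`
is composition with `f`, so `f` can be read off from its image.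

Part (2) reduces to (1). The components of the symmetric difference of two dimer coverings are
pairwise disjoint even cycles, and they span the hull (`exists_isHull`). A triple is flat exactly
when it lies in a common cube: at each vertex of the graph at most one cycle of a cube passes, and
conversely the edgewise majority of a flat triple is a dimer covering at which a cube containing all
three can be based (`inCommonCube_of_isFlat`). -/

noncomputable section

open CategoryTheory

/-! ### Morphisms of presented groupoids -/

namespace TriangleGroupoid

variable {V : Type*} {R : V → V → V → Prop}

/-- A property of morphisms that is stable under composition and inversion and that holds for
identities and generators holds for all morphisms. -/
theorem hom_induction {W : ∀ A B : V, (obj R A ⟶ obj R B) → Prop}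
    (id : ∀ A, W A A (𝟙 _))
    (comp : ∀ (A B C) (f : obj R A ⟶ obj R B) (g : obj R B ⟶ obj R C),
      W A B f → W B C g → W A C (f ≫ g))
    (inv : ∀ (A B) (f : obj R A ⟶ obj R B), W A B f → W B A (Groupoid.inv f))
    (gen : ∀ A B, W _ _ (gen R A B)) {A B : V} (f : obj R A ⟶ obj R B) : W A B f := by
  have key : ∀ {A B : Quiver.Symmetrify (PairQuiver V)} (p : Quiver.Path A B),
      W (PairQuiver.as A) (PairQuiver.as B) (Quot.mk _ (Quot.mk _ p)) := by
    intro A B p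
    induction p with
    | nil => exact id _
    | cons p e ih =>
      rcases e with e | e
      · exact comp _ _ _ _ _ ih (gen _ _)
      · exact comp _ _ _ _ _ ih (inv _ _ _ (gen _ _))
  have h : ∃ p : Quiver.Path (V := Quiver.Symmetrify (PairQuiver V)) (⟨A⟩ : PairQuiver V)
      (⟨B⟩ : PairQuiver V), f = Quot.mk _ (Quot.mk _ p) := by
    obtain ⟨f', rfl⟩ := Quot.exists_rep f
    obtain ⟨p, rfl⟩ := Quot.exists_rep f'
    exact ⟨p, rfl⟩
  obtain ⟨p, rfl⟩ := h
  exact key p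

theorem gen_comp {A B C : V} (h : R A B C) : gen R A B ≫ gen R B C = gen R A C :=
  (CategoryTheory.Quotient.sound _ (.triangle A B C h)).symm

theorem gen_self {A : V} (h : R A A A) : gen R A A = 𝟙 (obj R A) :=
  (cancel_epi (gen R A A)).1 (by rw [gen_comp h, Category.comp_id])

theorem lift_obj_bijective {C : Type*} [Groupoid C] (F : V → C) (hF : Function.Bijective F)
    (z : ∀ A B : V, F A ⟶ F B) (hz : ∀ A B D : V, R A B D → z A D = z A B ≫ z B D) :
    Function.Bijective (lift F z hz).obj := by
  have h : Function.Bijective fun X : TriangleGroupoid R => X.as.as.as :=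
    ⟨fun X Y h => by
      change X.as.as.as = Y.as.as.as at h
      change obj R X.as.as.as = obj R Y.as.as.as
      rw [h], fun A => ⟨obj R A, rfl⟩⟩
  exact hF.comp h

end TriangleGroupoid

/-! ### The fundamental groupoid of a space covered by open stars -/

/-- Makes all path classes in the interval with given endpoints equal, so that segments of a path
compose regardless of the chosen parametrizations. -/
instance : ContractibleSpace unitInterval :=
  (convex_Icc (0 : ℝ) 1).contractibleSpace ⟨0, by simp⟩

namespace FundamentalGroupoid

variable {X : Type*} [TopologicalSpace X]

/-- The morphism between two points on a path given by the path. -/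
def segment {x y : X} (γ : Path x y) (s t : unitInterval) :
    (⟨γ s⟩ : FundamentalGroupoid X) ⟶ ⟨γ t⟩ :=
  (FundamentalGroupoid.map γ.toContinuousMap).map
    (X := ⟨s⟩) (Y := ⟨t⟩) (Path.Homotopic.Quotient.mk (PathConnectedSpace.somePath s t))

theorem segment_comp {x y : X} (γ : Path x y) (r s t : unitInterval) :
    segment γ r s ≫ segment γ s t = segment γ r t := by
  refine ((FundamentalGroupoid.map γ.toContinuousMap).map_comp (X := ⟨r⟩) (Y := ⟨s⟩) (Z := ⟨t⟩)
    _ _).symm.trans ?_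
  exact congrArg _ (Subsingleton.elim (α := Path.Homotopic.Quotient r t) _ _)

theorem segment_self {x y : X} (γ : Path x y) (s : unitInterval) : segment γ s s = 𝟙 _ :=
  (cancel_epi (segment γ s s)).1 (by rw [segment_comp, Category.comp_id])

theorem exists_segment_eq {x y : X} (γ : Path x y) {s t : unitInterval} (hst : s ≤ t) :
    ∃ δ : Path (γ s) (γ t), segment γ s t = Path.Homotopic.Quotient.mk δ ∧
      ∀ u, ∃ v ∈ Set.Icc s t, δ u = γ v := by
  have hp : IsPathConnected (Set.Icc s t) := by
    have h := (convex_Icc (s : ℝ) t).isPathConnected ⟨s, by simpa using hst⟩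
    have h2 : Set.Icc s t = (Subtype.val : unitInterval → ℝ) ⁻¹' Set.Icc (s : ℝ) t := rfl
    rw [h2]
    refine h.preimage_coe fun u hu => ⟨s.2.1.trans hu.1, hu.2.trans t.2.2⟩
  obtain ⟨p, hp⟩ := hp.joinedIn s ⟨le_rfl, hst⟩ t ⟨hst, le_rfl⟩
  refine ⟨p.map γ.continuous, ?_, fun u => ⟨p u, hp u, rfl⟩⟩
  rw [segment, Subsingleton.elim (Path.Homotopic.Quotient.mk (PathConnectedSpace.somePath s t))
    (Path.Homotopic.Quotient.mk p)]
  rfl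

theorem segment_zero_one {x y : X} (γ : Path x y) :
    segment γ 0 1 = (Path.Homotopic.Quotient.mk γ).cast γ.source γ.target := by
  let p : Path (0 : unitInterval) 1 := ⟨⟨_root_.id, continuous_id⟩, rfl, rfl⟩
  rw [segment, Subsingleton.elim (Path.Homotopic.Quotient.mk (PathConnectedSpace.somePath 0 1))
    (Path.Homotopic.Quotient.mk p), ← Path.Homotopic.Quotient.mk_cast]
  rfl

end FundamentalGroupoid

/-- A cover of a space by pointed open sets `U i`, each of which contracts to its base point along
rays. -/
structure RadialCover (X : Type*) [TopologicalSpace X] (ι : Type*) where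
  U : ι → Set X
  isOpen : ∀ i, IsOpen (U i)
  cover : ∀ x, ∃ i, x ∈ U i
  center : ι → X
  center_mem : ∀ i, center i ∈ U i
  ray : ∀ i x, x ∈ U i → Path x (center i)
  ray_mem : ∀ i x (h : x ∈ U i) t, ray i x h t ∈ U i
  -- For `x = y` this says that loops in `U i` are null-homotopic in `X`; the homotopy may leave `U
  -- i`.
  path_trans_ray : ∀ i x y (hx : x ∈ U i) (hy : y ∈ U i) (γ : Path x y), (∀ t, γ t ∈ U i) →
    (Path.Homotopic.Quotient.mk γ).trans (.mk (ray i y hy)) = .mk (ray i x hx)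

namespace RadialCover

open FundamentalGroupoid

variable {X : Type*} [TopologicalSpace X] {ι : Type*} (𝒰 : RadialCover X ι)

/-- The full subgroupoid of the fundamental groupoid on the base points. -/
abbrev CenterGroupoid : Type _ :=
  InducedCategory (FundamentalGroupoid X) fun i : ι => (⟨𝒰.center i⟩ : FundamentalGroupoid X)

/-- A base point as an object of the fundamental groupoid on the base points. -/
def centerObj (i : ι) : 𝒰.CenterGroupoid := i

/-- The homotopy class of a ray. -/
def rayClass (i : ι) (x : X) (h : x ∈ 𝒰.U i) :
    (⟨x⟩ : FundamentalGroupoid X) ⟶ ⟨𝒰.center i⟩ :=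
  Path.Homotopic.Quotient.mk (𝒰.ray i x h)

theorem mk_comp_rayClass {i : ι} {x y : X} (hx : x ∈ 𝒰.U i) (hy : y ∈ 𝒰.U i) (γ : Path x y)
    (hγ : ∀ t, γ t ∈ 𝒰.U i) {f : (⟨x⟩ : FundamentalGroupoid X) ⟶ ⟨y⟩}
    (hf : f = Path.Homotopic.Quotient.mk γ) :
    f ≫ 𝒰.rayClass i y hy = 𝒰.rayClass i x hx := by
  subst hf
  exact 𝒰.path_trans_ray i x y hx hy γ hγ

/-- The ray at the center is not required to be constant, but `path_trans_ray` applied to this ray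
itself makes its class idempotent, hence trivial. -/
theorem rayClass_center (i : ι) :
    𝒰.rayClass i (𝒰.center i) (𝒰.center_mem i) = 𝟙 _ := by
  have h := 𝒰.mk_comp_rayClass (𝒰.center_mem i) (𝒰.center_mem i) (𝒰.ray i _ (𝒰.center_mem i))
    (𝒰.ray_mem i _ _) (f := 𝒰.rayClass i _ (𝒰.center_mem i)) rfl
  exact (cancel_epi (𝒰.rayClass i _ (𝒰.center_mem i))).1 (by rw [h, Category.comp_id])

theorem eq_cast_of_comp_rayClass {i j : ι} {x y : X} (hx : x = 𝒰.center i) (hy : y = 𝒰.center j)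
    (hx' : x ∈ 𝒰.U i) (hy' : y ∈ 𝒰.U j) {g : (⟨x⟩ : FundamentalGroupoid X) ⟶ ⟨y⟩}
    {f : (⟨𝒰.center i⟩ : FundamentalGroupoid X) ⟶ ⟨𝒰.center j⟩}
    (h : g ≫ 𝒰.rayClass j y hy' = 𝒰.rayClass i x hx' ≫ f) :
    f = Path.Homotopic.Quotient.cast g hx.symm hy.symm := by
  subst hx hy
  rw [rayClass_center, rayClass_center, Category.comp_id, Category.id_comp] at h
  rw [← h]
  exact (Path.Homotopic.Quotient.cast_rfl_rfl _).symm

variable {R : ι → ι → ι → Prop} (z : ∀ i j : ι, 𝒰.centerObj i ⟶ 𝒰.centerObj j)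
  (hz : ∀ i j k : ι, R i j k → z i k = z i j ≫ z j k)

/-- The image in the fundamental groupoid of a morphism of the presented groupoid. -/
def homMap {i j : ι} (f : TriangleGroupoid.obj R i ⟶ TriangleGroupoid.obj R j) :
    (⟨𝒰.center i⟩ : FundamentalGroupoid X) ⟶ ⟨𝒰.center j⟩ :=
  ((TriangleGroupoid.lift 𝒰.centerObj z hz).map f).hom

/-- The image in the fundamental groupoid of a generator. -/
def genHom (i j : ι) : (⟨𝒰.center i⟩ : FundamentalGroupoid X) ⟶ ⟨𝒰.center j⟩ := (z i j).hom

theorem homMap_gen (i j : ι) : 𝒰.homMap z hz (TriangleGroupoid.gen R i j) = 𝒰.genHom z i j :=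
  congrArg InducedCategory.Hom.hom (TriangleGroupoid.lift_gen 𝒰.centerObj z hz i j)

theorem homMap_id (i : ι) : 𝒰.homMap z hz (𝟙 (TriangleGroupoid.obj R i)) = 𝟙 _ :=
  congrArg InducedCategory.Hom.hom ((TriangleGroupoid.lift 𝒰.centerObj z hz).map_id _)

theorem homMap_comp {i j k : ι} (f : TriangleGroupoid.obj R i ⟶ TriangleGroupoid.obj R j)
    (g : TriangleGroupoid.obj R j ⟶ TriangleGroupoid.obj R k) :
    𝒰.homMap z hz (f ≫ g) = 𝒰.homMap z hz f ≫ 𝒰.homMap z hz g :=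
  congrArg InducedCategory.Hom.hom ((TriangleGroupoid.lift 𝒰.centerObj z hz).map_comp f g)

/-- Induction over the subdivision: a piece inside `U k` is absorbed by the rays to the center of `U
k`, and passing from `U k` to `U j` at a division point appends the generator from `k` to `j`. -/
theorem exists_segment_comp_rayClass
    (hray : ∀ i j x (hi : x ∈ 𝒰.U i) (hj : x ∈ 𝒰.U j),
      𝒰.rayClass i x hi ≫ 𝒰.genHom z i j = 𝒰.rayClass j x hj)
    {x y : X} (γ : Path x y) (t : ℕ → unitInterval)
    (ht : Monotone t) (htc : ∀ n, ∃ i, ∀ s ∈ Set.Icc (t n) (t (n + 1)), γ s ∈ 𝒰.U i)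
    (i : ι) (hi : γ (t 0) ∈ 𝒰.U i) (n : ℕ) (j : ι) (hj : γ (t n) ∈ 𝒰.U j) :
    ∃ f : TriangleGroupoid.obj R i ⟶ TriangleGroupoid.obj R j,
      segment γ (t 0) (t n) ≫ 𝒰.rayClass j _ hj = 𝒰.rayClass i _ hi ≫ 𝒰.homMap z hz f := by
  induction n generalizing j with
  | zero =>
    refine ⟨TriangleGroupoid.gen R i j, ?_⟩
    rw [homMap_gen, hray i j _ hi hj, segment_self, Category.id_comp]
  | succ n ih =>
    obtain ⟨k, hk⟩ := htc n
    have h₀ := hk _ ⟨le_rfl, ht n.le_succ⟩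
    have h₁ := hk _ ⟨ht n.le_succ, le_rfl⟩
    obtain ⟨f, hf⟩ := ih k h₀
    refine ⟨f ≫ TriangleGroupoid.gen R k j, ?_⟩
    obtain ⟨δ, hδ, hδ'⟩ := exists_segment_eq γ (ht n.le_succ)
    have h₂ : segment γ (t n) (t (n + 1)) ≫ 𝒰.rayClass k _ h₁ = 𝒰.rayClass k _ h₀ := by
      refine 𝒰.mk_comp_rayClass h₀ h₁ δ (fun u => ?_) hδ
      obtain ⟨v, hv, h⟩ := hδ' u
      exact h ▸ hk v hv
    rw [homMap_comp, homMap_gen, ← Category.assoc, ← hf, ← h₂, ← segment_comp γ (t 0) (t n),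
      ← hray k j _ h₁ hj]
    simp only [Category.assoc]

theorem homMap_surjective
    (hray : ∀ i j x (hi : x ∈ 𝒰.U i) (hj : x ∈ 𝒰.U j),
      𝒰.rayClass i x hi ≫ 𝒰.genHom z i j = 𝒰.rayClass j x hj) (i j : ι) :
    Function.Surjective
      (𝒰.homMap z hz : (TriangleGroupoid.obj R i ⟶ TriangleGroupoid.obj R j) → _) := by
  intro g
  obtain ⟨γ, rfl⟩ := Path.Homotopic.Quotient.mk_surjective g
  obtain ⟨t, t_zero, t_mono, ⟨n, hn⟩, ht⟩ :=
    exists_monotone_Icc_subset_open_cover_unitInterval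
      (c := fun i => γ ⁻¹' 𝒰.U i) (fun i => (𝒰.isOpen i).preimage γ.continuous)
      fun s _ => Set.mem_iUnion.2 (𝒰.cover (γ s))
  have h1 := hn n le_rfl
  have hi : γ (t 0) = 𝒰.center i := by rw [t_zero, γ.source]
  have hj : γ (t n) = 𝒰.center j := by rw [h1, γ.target]
  have hi' : γ (t 0) ∈ 𝒰.U i := by rw [hi]; exact 𝒰.center_mem i
  have hj' : γ (t n) ∈ 𝒰.U j := by rw [hj]; exact 𝒰.center_mem j
  obtain ⟨f, hf⟩ := 𝒰.exists_segment_comp_rayClass z hz hray γ t t_mono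
    (fun n => (ht n).imp fun k hk s hs => hk hs) i hi' n j hj'
  refine ⟨f, ?_⟩
  rw [𝒰.eq_cast_of_comp_rayClass hi hj hi' hj' hf]
  -- The ends `t 0` and `t n` equal `0` and `1` only propositionally; with variables in their place
  -- the equations can be substituted.
  have key : ∀ s u (hs : s = 0) (hu : u = 1) (hi : γ s = 𝒰.center i) (hj : γ u = 𝒰.center j),
      Path.Homotopic.Quotient.cast (segment γ s u) hi.symm hj.symm =
        Path.Homotopic.Quotient.mk γ := by
    rintro _ _ rfl rfl hi hj
    rw [segment_zero_one, Path.Homotopic.Quotient.cast_cast]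
    rfl
  exact key _ _ t_zero h1 hi hj

/-! #### The covering with fibre the automorphism group of an object of the presented groupoid -/

variable (R) in
/-- The automorphisms of an object of the presented groupoid, as a discrete space. -/
structure Fib (o : ι) where
  hom : TriangleGroupoid.obj R o ⟶ TriangleGroupoid.obj R o

instance (o : ι) : TopologicalSpace (Fib R o) := ⊥

instance (o : ι) : DiscreteTopology (Fib R o) := ⟨rfl⟩

open TriangleGroupoid in
/-- The action on the fibre of a morphism of the presented groupoid. -/
def shift (o : ι) {i j : ι} (f : obj R i ⟶ obj R j) (v : Fib R o) : Fib R o :=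
  -- A bundle core has one fixed fibre, so the morphisms from `o` to `i` are identified with the
  -- automorphisms of `o` by means of `gen R o i`. In these terms the action is composition with
  -- `f`.
  ⟨v.hom ≫ gen R o i ≫ f ≫ Groupoid.inv (gen R o j)⟩

theorem shift_id (o i : ι) (v : Fib R o) : shift o (𝟙 (TriangleGroupoid.obj R i)) v = v := by
  simp [shift]

theorem shift_comp (o : ι) {i j k : ι} (f : TriangleGroupoid.obj R i ⟶ TriangleGroupoid.obj R j)
    (g : TriangleGroupoid.obj R j ⟶ TriangleGroupoid.obj R k) (v : Fib R o) :
    shift o g (shift o f v) = shift o (f ≫ g) v := by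
  simp [shift]

variable (hR : ∀ i j k, (𝒰.U i ∩ 𝒰.U j ∩ 𝒰.U k).Nonempty → R i j k)

include hR in
theorem gen_center_self (i : ι) : TriangleGroupoid.gen R i i = 𝟙 _ :=
  TriangleGroupoid.gen_self (hR i i i
    ⟨𝒰.center i, ⟨𝒰.center_mem i, 𝒰.center_mem i⟩, 𝒰.center_mem i⟩)

/-- The covering of `X` with fibre the automorphism group of an object of the presented groupoid,
where the coordinate changes are given by the generators. -/
def core (o : ι) : FiberBundleCore ι X (Fib R o) where
  baseSet := 𝒰.U
  isOpen_baseSet := 𝒰.isOpen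
  indexAt x := (𝒰.cover x).choose
  mem_baseSet_at x := (𝒰.cover x).choose_spec
  coordChange i j _ v := shift o (TriangleGroupoid.gen R i j) v
  coordChange_self i x hx v := by rw [𝒰.gen_center_self hR, shift_id]
  continuousOn_coordChange i j :=
    ((continuous_of_discreteTopology (f := shift o (TriangleGroupoid.gen R i j))).comp
      continuous_snd).continuousOn
  coordChange_comp i j k x hx v := by
    rw [shift_comp, TriangleGroupoid.gen_comp (hR i j k ⟨x, hx⟩)]

theorem isCoveringMap (o : ι) : IsCoveringMap (𝒰.core hR o).proj :=
  FiberBundle.isCoveringMap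

/-- The point of the covering with given coordinate in the chart `U i`. -/
def chartPoint (o i : ι) (x : X) (v : Fib R o) : (𝒰.core hR o).proj ⁻¹' {x} :=
  ⟨⟨x, (𝒰.core hR o).coordChange i ((𝒰.core hR o).indexAt x) x v⟩, rfl⟩

theorem chartPoint_eq {o i j : ι} {x : X} (hi : x ∈ 𝒰.U i) (hj : x ∈ 𝒰.U j) (v : Fib R o) :
    𝒰.chartPoint hR o i x v = 𝒰.chartPoint hR o j x (shift o (TriangleGroupoid.gen R i j) v) := by
  have h := (𝒰.core hR o).coordChange_comp i j ((𝒰.core hR o).indexAt x) x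
    ⟨⟨hi, hj⟩, (𝒰.core hR o).mem_baseSet_at x⟩ v
  exact Subtype.ext (congrArg (Bundle.TotalSpace.mk (E := (𝒰.core hR o).Fiber) x) h.symm)

theorem chartPoint_injective (o i : ι) (x : X) :
    Function.Injective (𝒰.chartPoint hR o i x) := by
  intro v w h
  have h₀ : (𝒰.chartPoint hR o i x v).1 = (𝒰.chartPoint hR o i x w).1 := congrArg Subtype.val h
  have h' := eq_of_heq (Bundle.TotalSpace.mk.inj h₀).2
  have h'' := congrArg Fib.hom h'
  cases v
  exact congrArg Fib.mk ((cancel_mono _).1 h'')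

/-- Over a chart the covering is a product, so the lift of a path inside `U i` keeps its coordinate
constant. -/
theorem monodromy_of_mem {o i : ι} {x y : X} (γ : Path x y) (hγ : ∀ t, γ t ∈ 𝒰.U i)
    (v : Fib R o) :
    (𝒰.isCoveringMap hR o).monodromy (.mk γ) (𝒰.chartPoint hR o i x v) =
      𝒰.chartPoint hR o i y v := by
  let e := (𝒰.core hR o).localTriv i
  have hc : Continuous fun t => e.toOpenPartialHomeomorph.symm (γ t, v) :=
    e.toOpenPartialHomeomorph.continuousOn_symm.comp_continuous (by fun_prop) fun t => by
      rw [e.mem_target]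
      exact hγ t
  let Γ : Path (𝒰.chartPoint hR o i x v : (𝒰.core hR o).TotalSpace)
      (𝒰.chartPoint hR o i y v) := ⟨⟨_, hc⟩,
    congrArg (fun z => (𝒰.chartPoint hR o i z v : (𝒰.core hR o).TotalSpace)) γ.source,
    congrArg (fun z => (𝒰.chartPoint hR o i z v : (𝒰.core hR o).TotalSpace)) γ.target⟩
  refine (𝒰.isCoveringMap hR o).monodromy_eq_of_map_eq (Path.Homotopic.Quotient.mk Γ) ?_
  exact (Path.Homotopic.Quotient.mk_map Γ _).symm.trans (Path.Homotopic.Quotient.cast_rfl_rfl _).symm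

theorem monodromy_homMap (hne : ∀ i j, (𝒰.U i ∩ 𝒰.U j).Nonempty)
    (hray : ∀ i j x (hi : x ∈ 𝒰.U i) (hj : x ∈ 𝒰.U j),
      𝒰.rayClass i x hi ≫ 𝒰.genHom z i j = 𝒰.rayClass j x hj) (o : ι) {i j : ι}
    (f : TriangleGroupoid.obj R i ⟶ TriangleGroupoid.obj R j) (v : Fib R o) :
    (𝒰.isCoveringMap hR o).monodromy (𝒰.homMap z hz f) (𝒰.chartPoint hR o i (𝒰.center i) v) =
      𝒰.chartPoint hR o j (𝒰.center j) (shift o f v) := by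
  have hcomp : ∀ {a b c : X} (f : (⟨a⟩ : FundamentalGroupoid X) ⟶ ⟨b⟩) (g : (⟨b⟩ :
      FundamentalGroupoid X) ⟶ ⟨c⟩) (e), (𝒰.isCoveringMap hR o).monodromy (f ≫ g) e =
      (𝒰.isCoveringMap hR o).monodromy g ((𝒰.isCoveringMap hR o).monodromy f e) :=
    fun f g e => (𝒰.isCoveringMap hR o).monodromy_trans_apply f g e
  have hid : ∀ {a : X} (e), (𝒰.isCoveringMap hR o).monodromy
      (𝟙 (⟨a⟩ : FundamentalGroupoid X)) e = e :=
    fun e => congrFun (𝒰.isCoveringMap hR o).monodromy_refl e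
  induction f using TriangleGroupoid.hom_induction generalizing v with
  | id i => rw [homMap_id, shift_id]; exact hid _
  | comp i j k f g hf hg => 
    rw [homMap_comp]
    refine (hcomp _ _ _).trans ?_
    rw [hf, hg, shift_comp]
  | inv i j f hf =>
    have h := hf (shift o (Groupoid.inv f) v)
    rw [shift_comp, Groupoid.inv_comp, shift_id] at h
    rw [← h]
    refine (hcomp _ _ _).symm.trans ?_
    rw [← homMap_comp, Groupoid.comp_inv, homMap_id]
    exact hid _
  | gen i j =>
    -- The image of a generator is the reversed ray from `x` to the `i`-th center followed by the
    -- ray to the `j`-th one. Both rays preserve coordinates, so only the change of chart at `x`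
    -- acts.
    obtain ⟨x, hi, hj⟩ := hne i j
    have h₁ := 𝒰.monodromy_of_mem hR (𝒰.ray i x hi) (𝒰.ray_mem i x hi) v
    rw [← h₁, homMap_gen, 𝒰.chartPoint_eq hR hi hj]
    refine (hcomp (𝒰.rayClass i x hi) (𝒰.genHom z i j) _).symm.trans ?_
    rw [hray i j x hi hj]
    exact 𝒰.monodromy_of_mem hR (𝒰.ray j x hj) (𝒰.ray_mem j x hj) _

include hR in
theorem homMap_injective (hne : ∀ i j, (𝒰.U i ∩ 𝒰.U j).Nonempty)
    (hray : ∀ i j x (hi : x ∈ 𝒰.U i) (hj : x ∈ 𝒰.U j),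
      𝒰.rayClass i x hi ≫ 𝒰.genHom z i j = 𝒰.rayClass j x hj) (i j : ι) :
    Function.Injective
      (𝒰.homMap z hz : (TriangleGroupoid.obj R i ⟶ TriangleGroupoid.obj R j) → _) := by
  intro f g h
  -- Taking `o = i`, the monodromy moves the identity to `f` composed on both sides with fixed
  -- isomorphisms.
  have hf := 𝒰.monodromy_homMap z hz hR hne hray i f ⟨𝟙 _⟩
  rw [h, 𝒰.monodromy_homMap z hz hR hne hray i g ⟨𝟙 _⟩] at hf
  have h' := 𝒰.chartPoint_injective hR i j _ hf
  simp only [shift, Category.id_comp, Fib.mk.injEq] at h'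
  exact ((cancel_mono _).1 ((cancel_epi _).1 h')).symm

include hR in
/-- The fundamental groupoid of a radially covered space is presented by the pairwise
intersections, with a relation for each triple intersection. -/
theorem full_and_faithful (hne : ∀ i j, (𝒰.U i ∩ 𝒰.U j).Nonempty)
    (hray : ∀ i j x (hi : x ∈ 𝒰.U i) (hj : x ∈ 𝒰.U j),
      𝒰.rayClass i x hi ≫ 𝒰.genHom z i j = 𝒰.rayClass j x hj) :
    (TriangleGroupoid.lift 𝒰.centerObj z hz).Full ∧
      (TriangleGroupoid.lift 𝒰.centerObj z hz).Faithful := by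
  refine ⟨⟨fun {A B} g => ?_⟩, ⟨fun {A B} f g h => ?_⟩⟩
  · obtain ⟨f, hf⟩ := 𝒰.homMap_surjective z hz hray A.as.as.as B.as.as.as g.hom
    exact ⟨f, InducedCategory.hom_ext hf⟩
  · exact 𝒰.homMap_injective z hz hR hne hray A.as.as.as B.as.as.as
      (congrArg InducedCategory.Hom.hom h)

end RadialCover

/-! ### Combinatorics of based cubes: flips and vertices. -/

namespace GlidingSystem

section Combinatorics

open scoped Classical symmDiff

variable {G : Type*} [Group G] {𝒢 : GlidingSystem G}

omit [Group G] in
theorem symmDiff_subset {S T W : Finset G} (hT : T ⊆ S) (hW : W ⊆ S) : W ∆ T ⊆ S := fun s hs => by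
  rw [Finset.mem_symmDiff] at hs
  exact hs.elim (fun h => hW h.1) fun h => hT h.1

theorem not_indep_inv (𝒢 : GlidingSystem G) (s : G) : ¬ 𝒢.Indep s s⁻¹ := fun h =>
  𝒢.irrefl s⁻¹ (𝒢.glide_of_indep h).2 (𝒢.inv_left h)

theorem indep_inv_right {s t : G} (h : 𝒢.Indep s t) : 𝒢.Indep s t⁻¹ :=
  𝒢.symm (𝒢.inv_left (𝒢.symm h))

/-- Inverts the elements of `T` and fixes all others. -/
def flipMap (T : Finset G) (s : G) : G := if s ∈ T then s⁻¹ else s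

theorem flipMap_of_mem {T : Finset G} {s : G} (h : s ∈ T) : flipMap T s = s⁻¹ := if_pos h

theorem flipMap_of_notMem {T : Finset G} {s : G} (h : s ∉ T) : flipMap T s = s := if_neg h

theorem indep_flipMap (T : Finset G) {s t : G} (h : 𝒢.Indep s t) :
    𝒢.Indep (flipMap T s) (flipMap T t) := by
  unfold flipMap
  split_ifs
  exacts [𝒢.inv_left (indep_inv_right h), 𝒢.inv_left h, indep_inv_right h, h]

theorem flipDirs_eq_image {S T : Finset G} (h : T ⊆ S) :
    BasedCube.flipDirs S T = S.image (flipMap T) := by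
  ext g
  simp only [BasedCube.flipDirs, Finset.mem_union, Finset.mem_sdiff, Finset.mem_image]
  constructor
  · rintro (⟨hg, hg'⟩ | ⟨t, ht, rfl⟩)
    · exact ⟨g, hg, flipMap_of_notMem hg'⟩
    · exact ⟨t, h ht, flipMap_of_mem ht⟩
  · rintro ⟨s, hs, rfl⟩
    by_cases hT : s ∈ T
    · exact Or.inr ⟨s, hT, (flipMap_of_mem hT).symm⟩
    · rw [flipMap_of_notMem hT]
      exact Or.inl ⟨hs, hT⟩

/-- A collision would require distinct independent glides of the form `s` and `s⁻¹`; these cannot be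
independent, since then `s⁻¹` would be independent of itself. -/
theorem IsIndepSet.injOn_flipMap {S : Finset G} (hS : 𝒢.IsIndepSet S) (T : Finset G) :
    Set.InjOn (flipMap T) (S : Set G) := by
  intro s hs t ht h
  by_contra hst
  have hind := hS.2 hs ht hst
  unfold flipMap at h
  split_ifs at h
  · exact hst (inv_injective h)
  · exact 𝒢.not_indep_inv s (h ▸ hind)
  · exact 𝒢.not_indep_inv t (h ▸ 𝒢.symm hind)
  · exact hst h

theorem IsIndepSet.image_flipMap {S : Finset G} (hS : 𝒢.IsIndepSet S) (T : Finset G) :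
    𝒢.IsIndepSet (S.image (flipMap T)) := by
  constructor
  · simp only [Finset.mem_image]
    rintro _ ⟨s, hs, rfl⟩
    unfold flipMap
    split_ifs
    exacts [𝒢.inv_mem (hS.1 s hs), hS.1 s hs]
  · simp only [Finset.coe_image]
    rintro _ ⟨s, hs, rfl⟩ _ ⟨t, ht, rfl⟩ h
    exact indep_flipMap T (hS.2 hs ht fun h' => h (h' ▸ rfl))

theorem IsIndepSet.commute {S : Finset G} (hS : 𝒢.IsIndepSet S) {s t : G} (hs : s ∈ S)
    (ht : t ∈ S) : Commute s t := by
  by_cases h : s = t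
  · rw [h]
  · exact 𝒢.comm (hS.2 hs ht h)

/-- The product `∏ s ^ n s` over an independent set of glides. -/
def IsIndepSet.zprod {S : Finset G} (hS : 𝒢.IsIndepSet S) (n : G → ℤ) : G :=
  S.noncommProd (fun s => s ^ n s) fun _ hs _ ht _ => (hS.commute hs ht).zpow_zpow _ _

theorem IsIndepSet.zprod_congr {S : Finset G} (hS : 𝒢.IsIndepSet S) {m n : G → ℤ}
    (h : ∀ s ∈ S, s ^ m s = s ^ n s) : hS.zprod m = hS.zprod n :=
  Finset.noncommProd_congr rfl h _

theorem IsIndepSet.zprod_add {S : Finset G} (hS : 𝒢.IsIndepSet S) (m n : G → ℤ) :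
    hS.zprod (fun s => m s + n s) = hS.zprod m * hS.zprod n := by
  refine (Finset.noncommProd_congr rfl (fun s _ => zpow_add s (m s) (n s)) _).trans
    (Finset.noncommProd_mul_distrib _ _ _ _ ?_)
  exact fun _ hs _ ht _ => (hS.commute hs ht).zpow_zpow _ _

theorem IsIndepSet.zprod_empty (hS : 𝒢.IsIndepSet ∅) (n : G → ℤ) : hS.zprod n = 1 :=
  Finset.noncommProd_empty _ _

variable (𝒢) in
/-- The product of an independent set of glides (and `1` for other sets). -/
def br (S : Finset G) : G := if h : 𝒢.IsIndepSet S then bracket S h else 1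

theorem bracket_eq_br {S : Finset G} (hS : 𝒢.IsIndepSet S) : bracket S hS = 𝒢.br S :=
  (dif_pos hS).symm

theorem br_empty : 𝒢.br ∅ = 1 := by
  rw [← bracket_eq_br ⟨by simp, by simp⟩]
  exact Finset.noncommProd_empty _ _

theorem IsIndepSet.br_insert {S : Finset G} {a : G} (hS : 𝒢.IsIndepSet (insert a S))
    (ha : a ∉ S) : 𝒢.br (insert a S) = a * 𝒢.br S := by
  rw [← bracket_eq_br hS, ← bracket_eq_br (hS.subset (Finset.subset_insert a S))]
  exact Finset.noncommProd_insert_of_notMem S a id _ ha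

theorem IsIndepSet.zprod_insert {S : Finset G} {a : G} (hS : 𝒢.IsIndepSet (insert a S))
    (ha : a ∉ S) (n : G → ℤ) :
    hS.zprod n = a ^ n a * (hS.subset (Finset.subset_insert a S)).zprod n :=
   Finset.noncommProd_insert_of_notMem S a _ _ ha

theorem IsIndepSet.br_image {S : Finset G} (hS : 𝒢.IsIndepSet S) {T V : Finset G} (hV : V ⊆ S) :
    𝒢.br (V.image (flipMap T)) =
      hS.zprod fun s => if s ∈ V then (if s ∈ T then -1 else 1) else 0 := by
  induction S using Finset.induction_on generalizing V with
  | empty =>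
    rw [Finset.subset_empty.1 hV, Finset.image_empty, br_empty, hS.zprod_empty]
  | insert a S ha ih =>
    have hS' := hS.subset (Finset.subset_insert a S)
    rw [hS.zprod_insert ha]
    by_cases haV : a ∈ V
    · have hV' : V.erase a ⊆ S := by
        rw [← Finset.erase_insert ha]
        exact Finset.erase_subset_erase a hV
      have h1 : V.image (flipMap T) = insert (flipMap T a) ((V.erase a).image (flipMap T)) := by
        rw [← Finset.image_insert, Finset.insert_erase haV]
      have h2 : flipMap T a ∉ (V.erase a).image (flipMap T) := by
        rw [Finset.mem_image]
        rintro ⟨b, hb, hba⟩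
        have := hS.injOn_flipMap T (Finset.mem_insert_of_mem (hV' hb))
          (Finset.mem_insert_self a S) hba
        rw [this] at hb
        exact Finset.notMem_erase a V hb
      have h3 := (hS.subset hV).image_flipMap T
      rw [h1] at h3 ⊢
      rw [h3.br_insert h2, ih hS' hV', if_pos haV]
      congr 1
      · unfold flipMap
        split_ifs <;> simp
      · refine zprod_congr _ fun s hs => ?_
        have : s ≠ a := fun h => ha (h ▸ hs)
        simp [this]
    · have hV' : V ⊆ S := (Finset.subset_insert_iff_of_notMem haV).1 hV
      rw [ih hS' hV', if_neg haV, zpow_zero, one_mul]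

theorem IsIndepSet.br_eq {S : Finset G} (hS : 𝒢.IsIndepSet S) {V : Finset G} (hV : V ⊆ S) :
    𝒢.br V = hS.zprod fun s => if s ∈ V then 1 else 0 := by
  have h := hS.br_image (T := ∅) hV
  have h' : flipMap (∅ : Finset G) = id := by
    ext s
    simp [flipMap]
  simpa [h'] using h

/-- All factors commute, so exponents can be compared glide by glide: `s ∈ W ∆ T` contributes `-1`
if `s ∈ T` and `1` otherwise, and adding the indicator of `T` gives the indicator of `W`. -/
theorem IsIndepSet.br_image_symmDiff {S : Finset G} (hS : 𝒢.IsIndepSet S) {T W : Finset G}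
    (hT : T ⊆ S) (hW : W ⊆ S) :
    𝒢.br ((W ∆ T).image (flipMap T)) * 𝒢.br T = 𝒢.br W := by
  have h : W ∆ T ⊆ S := symmDiff_subset hT hW
  rw [hS.br_image h, hS.br_eq hT, hS.br_eq hW, ← hS.zprod_add]
  refine hS.zprod_congr fun s _ => ?_
  simp only [Finset.mem_symmDiff]
  congr 1
  by_cases h1 : s ∈ T <;> by_cases h2 : s ∈ W <;> simp [h1, h2]

namespace BasedCube

variable (q : 𝒢.BasedCube)

theorem indep : 𝒢.IsIndepSet q.dirs := q.cubic.choose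

/-- The vertex `[T]A` of the based cube `(A, S)`. -/
def vtx (T : Finset G) : G := 𝒢.br T * q.base

theorem vertex_eq_vtx {T : Finset G} (hT : T ⊆ q.dirs) : q.vertex T hT = q.vtx T := by
  rw [vertex, bracket_eq_br, vtx]

theorem vtx_empty : q.vtx ∅ = q.base := by rw [vtx, br_empty, one_mul]

theorem mem_vertices {A : G} : A ∈ q.vertices ↔ ∃ T ⊆ q.dirs, q.vtx T = A := by
  constructor
  · rintro ⟨T, hT, rfl⟩
    exact ⟨T, hT, (q.vertex_eq_vtx hT).symm⟩
  · rintro ⟨T, hT, rfl⟩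
    exact ⟨T, hT, (q.vertex_eq_vtx hT).symm⟩

theorem br_injective {S : Finset G} (hS : 𝒢.IsCubic S) {T₁ T₂ : Finset G} (h₁ : T₁ ⊆ S)
    (h₂ : T₂ ⊆ S) (h : 𝒢.br T₁ = 𝒢.br T₂) : T₁ = T₂ := by
  obtain ⟨hi, hS⟩ := hS
  refine hS T₁ T₂ h₁ h₂ ?_
  rw [bracket_eq_br, bracket_eq_br, h]

theorem vtx_injective {T₁ T₂ : Finset G} (h₁ : T₁ ⊆ q.dirs) (h₂ : T₂ ⊆ q.dirs)
    (h : q.vtx T₁ = q.vtx T₂) : T₁ = T₂ :=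
  br_injective q.cubic h₁ h₂ (mul_right_cancel h)

theorem isCubic_of_br {S : Finset G} (hS : 𝒢.IsIndepSet S)
    (h : ∀ T₁ T₂, T₁ ⊆ S → T₂ ⊆ S → 𝒢.br T₁ = 𝒢.br T₂ → T₁ = T₂) : 𝒢.IsCubic S := by
  refine ⟨hS, fun T₁ T₂ h₁ h₂ h' => h T₁ T₂ h₁ h₂ ?_⟩
  rwa [bracket_eq_br, bracket_eq_br] at h'

/-- Parametrizes the vertices of a flipped cube by subsets `W` of the original directions, so that
`W` labels the same vertex before and after the flip. -/
theorem exists_eq_image_symmDiff {S T U : Finset G} (hT : T ⊆ S)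
    (hU : U ⊆ S.image (flipMap T)) : ∃ W ⊆ S, U = (W ∆ T).image (flipMap T) := by
  obtain ⟨V, hV, rfl⟩ := Finset.subset_image_iff.1 hU
  refine ⟨V ∆ T, symmDiff_subset hT (by exact_mod_cast hV), ?_⟩
  rw [symmDiff_symmDiff_cancel_right]

theorem isCubic_image_flipMap {S T : Finset G} (hS : 𝒢.IsCubic S) (hT : T ⊆ S) :
    𝒢.IsCubic (S.image (flipMap T)) := by
  have hi := hS.choose
  refine isCubic_of_br (hi.image_flipMap T) fun U₁ U₂ h₁ h₂ h => ?_
  obtain ⟨W₁, hW₁, rfl⟩ := exists_eq_image_symmDiff hT h₁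
  obtain ⟨W₂, hW₂, rfl⟩ := exists_eq_image_symmDiff hT h₂
  have h' : 𝒢.br W₁ = 𝒢.br W₂ := by
    rw [← hi.br_image_symmDiff hT hW₁, ← hi.br_image_symmDiff hT hW₂, h]
  rw [br_injective hS hW₁ hW₂ h']

/-- The based cube `([T]A, S_T)`. -/
def flip (T : Finset G) (hT : T ⊆ q.dirs) : 𝒢.BasedCube where
  base := q.vtx T
  dirs := q.dirs.image (flipMap T)
  cubic := isCubic_image_flipMap q.cubic hT

theorem isFlip_flip (T : Finset G) (hT : T ⊆ q.dirs) : q.IsFlip (q.flip T hT) T :=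
  ⟨hT, (q.vertex_eq_vtx hT).symm, (flipDirs_eq_image hT).symm⟩

theorem IsFlip.eq_flip {q q' : 𝒢.BasedCube} {T : Finset G} (h : q.IsFlip q' T) :
    ∃ hT : T ⊆ q.dirs, q' = q.flip T hT := by
  obtain ⟨hT, hb, hd⟩ := h
  refine ⟨hT, ?_⟩
  obtain ⟨b, d, c⟩ := q'
  rw [q.vertex_eq_vtx] at hb
  rw [flipDirs_eq_image hT] at hd
  subst hb hd
  rfl

theorem vtx_flip {T W : Finset G} (hT : T ⊆ q.dirs) (hW : W ⊆ q.dirs) :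
    (q.flip T hT).vtx ((W ∆ T).image (flipMap T)) = q.vtx W := by
  rw [vtx, vtx, ← q.indep.br_image_symmDiff hT hW, mul_assoc]
  rfl

theorem vertices_flip (T : Finset G) (hT : T ⊆ q.dirs) :
    (q.flip T hT).vertices = q.vertices := by
  ext A
  rw [mem_vertices, mem_vertices]
  constructor
  · rintro ⟨U, hU, rfl⟩
    obtain ⟨W, hW, rfl⟩ := exists_eq_image_symmDiff hT hU
    exact ⟨W, hW, (q.vtx_flip hT hW).symm⟩
  · rintro ⟨W, hW, rfl⟩
    exact ⟨_, Finset.image_subset_image (symmDiff_subset hT hW), q.vtx_flip hT hW⟩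

theorem toCube_flip (T : Finset G) (hT : T ⊆ q.dirs) : (q.flip T hT).toCube = q.toCube :=
  (Quot.sound ⟨T, q.isFlip_flip T hT⟩).symm

theorem vertices_eq_of_toCube_eq {q q' : 𝒢.BasedCube} (h : q.toCube = q'.toCube) :
    q.vertices = q'.vertices := by
  refine congrArg (Quot.lift (fun q : 𝒢.BasedCube => q.vertices) ?_) h
  rintro q q' ⟨T, h⟩
  obtain ⟨hT, rfl⟩ := h.eq_flip
  exact (q.vertices_flip T hT).symm

theorem vertices_toCube : q.toCube.vertices = q.vertices := by
  ext A
  constructor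
  · rintro ⟨q', h, hA⟩
    rwa [← vertices_eq_of_toCube_eq h]
  · exact fun hA => ⟨q, rfl, hA⟩

/-- Every vertex of a cube is the base of a based cube that represents it. -/
theorem exists_base_eq {A : G} (hA : A ∈ q.vertices) :
    ∃ q' : 𝒢.BasedCube, q'.toCube = q.toCube ∧ q'.base = A := by
  obtain ⟨T, hT, rfl⟩ := q.mem_vertices.1 hA
  exact ⟨q.flip T hT, q.toCube_flip T hT, rfl⟩

end BasedCube

theorem Cube.exists_rep (Q : 𝒢.Cube) : ∃ q : 𝒢.BasedCube, q.toCube = Q := Quot.exists_rep Q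

end Combinatorics

end GlidingSystem

/-! ### Multilinear interpolation of functions on the vertices. -/

namespace GlidingSystem

section Weights

open scoped Classical symmDiff

variable {G : Type*} [Group G] {𝒢 : GlidingSystem G}

/-- The weight of the vertex of `I^S` given by `T ⊆ S` at the point `x`: the product of `x s` for
`s ∈ T` and of `1 - x s` for `s ∈ S \ T`. -/
def weight (S : Finset G) (x : G → ℝ) (T : Finset G) : ℝ :=
  (∏ s ∈ T, x s) * ∏ s ∈ S \ T, (1 - x s)

omit [Group G] in
theorem weight_eq_prod {S T : Finset G} (x : G → ℝ) (h : T ⊆ S) :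
    weight S x T = ∏ s ∈ S, if s ∈ T then x s else 1 - x s := by
  rw [Finset.prod_ite, weight, Finset.filter_mem_eq_inter, Finset.inter_eq_right.2 h,
    Finset.filter_notMem_eq_sdiff]

omit [Group G] in
theorem sum_weight (S : Finset G) (x : G → ℝ) : ∑ T ∈ S.powerset, weight S x T = 1 := by
  unfold weight
  rw [← Finset.prod_add]
  simp

omit [Group G] in
-- The weights are the distribution of a random subset of `S` containing each `u` independently with
-- probability `x u`; the expected indicator of `s` is `x s`.
theorem sum_weight_of_mem {S : Finset G} (x : G → ℝ) {s : G} (hs : s ∈ S) :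
    ∑ T ∈ S.powerset, weight S x T * (if s ∈ T then 1 else 0) = x s := by
  have h := Finset.prod_add x (fun u => if u = s then 0 else 1 - x u) S
  have h' : ∏ u ∈ S, (x u + if u = s then 0 else 1 - x u) = x s := by
    rw [Finset.prod_eq_single s]
    · simp
    · intro u _ hu
      simp [hu]
    · exact fun h => absurd hs h
  rw [← h', h]
  refine Finset.sum_congr rfl fun T _ => ?_
  unfold weight
  rw [mul_assoc]
  congr 1
  split_ifs with hT
  · rw [mul_one]
    refine Finset.prod_congr rfl fun u hu => ?_
    rw [if_neg]
    rintro rfl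
    exact (Finset.mem_sdiff.1 hu).2 hT
  · rw [mul_zero]
    exact (Finset.prod_eq_zero (f := fun u => if u = s then 0 else 1 - x u)
      (Finset.mem_sdiff.2 ⟨hs, hT⟩) (if_pos rfl)).symm

theorem IsIndepSet.weight_image {S V T : Finset G} (hS : 𝒢.IsIndepSet S) (hV : V ⊆ S)
    (x : G → ℝ) :
    weight (S.image (flipMap T)) x (V.image (flipMap T)) =
      weight S (fun s => x (flipMap T s)) V := by
  unfold weight
  rw [← Finset.image_sdiff_of_injOn (hS.injOn_flipMap T) hV, Finset.prod_image, Finset.prod_image]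
  · exact (hS.injOn_flipMap T).mono (by simp)
  · exact (hS.injOn_flipMap T).mono (by exact_mod_cast hV)

/-- The mean value of a function over the vertices of a cube, with the weights given by a point. -/
def mean (f : G → ℝ) (q : 𝒢.BasedCube) (x : G → ℝ) : ℝ :=
  ∑ T ∈ q.dirs.powerset, weight q.dirs x T * f (q.vtx T)

/-- Vertices off the face have weight `0` because some coordinate vanishes; for the others the
additional factors are `1 - 0`. -/
theorem mean_face (f : G → ℝ) {q q' : 𝒢.BasedCube} {x : G → ℝ} (hb : q.base = q'.base)
    (hS : q.dirs ⊆ q'.dirs) (hx : ∀ s, s ∉ q.dirs → x s = 0) : mean f q x = mean f q' x := by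
  unfold mean
  rw [← Finset.sum_subset (Finset.powerset_mono.2 hS)]
  · refine Finset.sum_congr rfl fun T hT => ?_
    have hT := Finset.mem_powerset.1 hT
    rw [weight_eq_prod x hT, weight_eq_prod x (hT.trans hS), ← Finset.prod_subset hS,
      BasedCube.vtx, BasedCube.vtx, hb]
    intro s _ hs
    rw [if_neg fun h => hs (hT h), hx s hs, sub_zero]
  · intro T _ hT
    rw [Finset.mem_powerset, Finset.not_subset] at hT
    obtain ⟨s, hs, hs'⟩ := hT
    rw [weight, Finset.prod_eq_zero hs (hx s hs'), zero_mul, zero_mul]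

/-- A flip only relabels the vertices, by `W ↦ (W ∆ T).image (flipMap T)`, and it exchanges the
factors `x s` and `1 - x s` accordingly. -/
theorem mean_flip (f : G → ℝ) (q : 𝒢.BasedCube) {T : Finset G} (hT : T ⊆ q.dirs) {x x' : G → ℝ}
    (hx : ∀ s ∈ q.dirs, x' (flipMap T s) = if s ∈ T then 1 - x s else x s) :
    mean f q x = mean f (q.flip T hT) x' := by
  refine Finset.sum_bij (fun W _ => (W ∆ T).image (flipMap T)) ?_ ?_ ?_ ?_
  · intro W hW
    exact Finset.mem_powerset.2
      (Finset.image_subset_image (symmDiff_subset hT (Finset.mem_powerset.1 hW)))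
  · intro W hW W' hW' h
    refine q.vtx_injective (Finset.mem_powerset.1 hW) (Finset.mem_powerset.1 hW') ?_
    rw [← q.vtx_flip hT (Finset.mem_powerset.1 hW), ← q.vtx_flip hT (Finset.mem_powerset.1 hW'), h]
  · intro U hU
    obtain ⟨W, hW, rfl⟩ := BasedCube.exists_eq_image_symmDiff hT (Finset.mem_powerset.1 hU)
    exact ⟨W, Finset.mem_powerset.2 hW, rfl⟩
  · intro W hW
    have hW := Finset.mem_powerset.1 hW
    rw [q.vtx_flip hT hW]
    congr 1
    refine Eq.trans ?_ (q.indep.weight_image (symmDiff_subset hT hW) x').symm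
    rw [weight_eq_prod _ hW, weight_eq_prod _ (symmDiff_subset hT hW)]
    refine Finset.prod_congr rfl fun s hs => ?_
    simp only [hx s hs, Finset.mem_symmDiff]
    by_cases h1 : s ∈ T <;> by_cases h2 : s ∈ W <;> simp [h1, h2]

theorem mean_single (q : 𝒢.BasedCube) (x : G → ℝ) {T : Finset G} (hT : T ⊆ q.dirs) :
    mean (fun B => if B = q.vtx T then 1 else 0) q x = weight q.dirs x T := by
  unfold mean
  rw [Finset.sum_eq_single T]
  · simp
  · intro U hU hUT
    exact mul_eq_zero_of_right _
      (if_neg fun h => hUT (q.vtx_injective (Finset.mem_powerset.1 hU) hT h))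
  · exact fun h => absurd (Finset.mem_powerset.2 hT) h

/-- The indicator function of the vertices `[T]A` of a based cube with `s ∈ T`. -/
def sideIndicator (q : 𝒢.BasedCube) (s : G) (B : G) : ℝ :=
  if ∃ T, T ⊆ q.dirs ∧ s ∈ T ∧ q.vtx T = B then 1 else 0

theorem sideIndicator_vtx (q : 𝒢.BasedCube) (s : G) {T : Finset G} (hT : T ⊆ q.dirs) :
    sideIndicator q s (q.vtx T) = if s ∈ T then 1 else 0 := by
  refine if_congr ⟨?_, fun h => ⟨T, hT, h, rfl⟩⟩ rfl rfl
  rintro ⟨U, hU, hs, h⟩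
  rwa [← q.vtx_injective hU hT h]

theorem mean_sideIndicator (q : 𝒢.BasedCube) (x : G → ℝ) {s : G} (hs : s ∈ q.dirs) :
    mean (sideIndicator q s) q x = x s := by
  rw [← sum_weight_of_mem x hs]
  refine Finset.sum_congr rfl fun T hT => ?_
  rw [sideIndicator_vtx q s (Finset.mem_powerset.1 hT)]

end Weights

/-! ### Interpolation on the glide complex, and cells as retracts. -/

section Complex

open scoped Classical symmDiff

variable {G : Type*} [Group G] {𝒢 : GlidingSystem G} {ℰ : Set G}

namespace CubePoint

/-- The coordinates of a point of a geometric cube, extended by `0`. -/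
def coord (p : 𝒢.CubePoint ℰ) (s : G) : ℝ :=
  if h : s ∈ p.1.1.dirs then (p.2 ⟨s, h⟩ : ℝ) else 0

theorem coord_of_mem (p : 𝒢.CubePoint ℰ) {s : G} (h : s ∈ p.1.1.dirs) :
    p.coord s = p.2 ⟨s, h⟩ := dif_pos h

theorem coord_of_notMem (p : 𝒢.CubePoint ℰ) {s : G} (h : s ∉ p.1.1.dirs) :
    p.coord s = 0 := dif_neg h

theorem coord_nonneg (p : 𝒢.CubePoint ℰ) (s : G) : 0 ≤ p.coord s := by
  unfold coord
  split_ifs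
  exacts [(p.2 _).2.1, le_rfl]

theorem coord_le_one (p : 𝒢.CubePoint ℰ) (s : G) : p.coord s ≤ 1 := by
  unfold coord
  split_ifs
  exacts [(p.2 _).2.2, zero_le_one]

theorem continuous_coord (s : G) : Continuous fun p : 𝒢.CubePoint ℰ => p.coord s := by
  refine continuous_sigma fun q => ?_
  unfold coord
  by_cases h : s ∈ q.1.dirs
  · simp only [h, dite_true]
    exact continuous_subtype_val.comp
      (continuous_apply (A := fun _ => unitInterval) (⟨s, h⟩ : {s : G // s ∈ q.1.dirs}))
  · simp only [h, dite_false]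
    fun_prop

theorem continuous_mean (f : G → ℝ) :
    Continuous fun p : 𝒢.CubePoint ℰ => mean f p.1.1 p.coord := by
  refine continuous_sigma fun q => ?_
  unfold mean weight
  have h : ∀ s, Continuous fun x => coord (⟨q, x⟩ : 𝒢.CubePoint ℰ) s := fun s =>
    (continuous_coord s).comp continuous_sigmaMk
  have h' : ∀ s, Continuous fun x => 1 - coord (⟨q, x⟩ : 𝒢.CubePoint ℰ) s := fun s =>
    continuous_const.sub (h s)
  have key : ∀ T, Continuous fun x => ((∏ s ∈ T, coord (⟨q, x⟩ : 𝒢.CubePoint ℰ) s) *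
      ∏ s ∈ q.1.dirs \ T, (1 - coord (⟨q, x⟩ : 𝒢.CubePoint ℰ) s)) * f (q.1.vtx T) := fun T =>
    ((continuous_finsetProd T fun s _ => h s).mul
      (continuous_finsetProd (q.1.dirs \ T) fun s _ => h' s)).mul continuous_const
  exact continuous_finsetSum q.1.dirs.powerset fun T _ => key T

theorem FaceRel.coord_eq {p p' : 𝒢.CubePoint ℰ} (h : p.FaceRel p') (s : G) :
    p.coord s = p'.coord s := by
  obtain ⟨_, hS, h₁, h₂⟩ := h
  by_cases hs : s ∈ p.1.1.dirs
  · rw [p.coord_of_mem hs, p'.coord_of_mem (hS hs), h₁ s hs (hS hs)]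
  · rw [p.coord_of_notMem hs]
    by_cases hs' : s ∈ p'.1.1.dirs
    · rw [p'.coord_of_mem hs', h₂ s hs' hs]
      rfl
    · rw [p'.coord_of_notMem hs']

theorem FaceRel.of_coord {p p' : 𝒢.CubePoint ℰ} (hb : p.1.1.base = p'.1.1.base)
    (hS : p.1.1.dirs ⊆ p'.1.1.dirs) (h : ∀ s ∈ p'.1.1.dirs, p.coord s = p'.coord s) :
    p.FaceRel p' := by
  refine ⟨hb, hS, fun s hs hs' => ?_, fun s hs' hs => ?_⟩
  · have := h s hs'
    rw [p.coord_of_mem hs, p'.coord_of_mem hs'] at this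
    exact Subtype.ext this
  · have := h s hs'
    rw [p.coord_of_notMem hs, p'.coord_of_mem hs'] at this
    exact Subtype.ext this.symm

theorem flipRel_iff {p p' : 𝒢.CubePoint ℰ} : p.FlipRel p' ↔
    ∃ (T : Finset G) (hT : T ⊆ p.1.1.dirs), p'.1.1 = p.1.1.flip T hT ∧
      ∀ s ∈ p.1.1.dirs, p'.coord (flipMap T s) = if s ∈ T then 1 - p.coord s else p.coord s := by
  constructor
  · rintro ⟨T, hflip, h₁, h₂⟩
    obtain ⟨hT, he⟩ := hflip.eq_flip
    refine ⟨T, hT, he, fun s hs => ?_⟩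
    have hs' : flipMap T s ∈ p'.1.1.dirs := by
      rw [he]
      exact Finset.mem_image_of_mem _ hs
    split_ifs with hsT
    · rw [flipMap_of_mem hsT] at hs' ⊢
      rw [coord_of_mem _ hs', coord_of_mem _ hs, h₂ s hsT hs hs', unitInterval.coe_symm_eq]
    · rw [flipMap_of_notMem hsT] at hs' ⊢
      rw [coord_of_mem _ hs', coord_of_mem _ hs, h₁ s hs hs' hsT]
  · rintro ⟨T, hT, he, h⟩
    refine ⟨T, he ▸ p.1.1.isFlip_flip T hT, fun s hs hs' hsT => ?_, fun s hsT hs hs' => ?_⟩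
    · have := h s hs
      rw [flipMap_of_notMem hsT, if_neg hsT, coord_of_mem _ hs, coord_of_mem _ hs'] at this
      exact Subtype.ext this
    · have := h s hs
      rw [flipMap_of_mem hsT, if_pos hsT, coord_of_mem _ hs, coord_of_mem _ hs'] at this
      exact Subtype.ext this

theorem FaceRel.mean_eq (f : G → ℝ) {p p' : 𝒢.CubePoint ℰ} (h : p.FaceRel p') :
    mean f p.1.1 p.coord = mean f p'.1.1 p'.coord := by
  rw [← funext h.coord_eq]
  exact mean_face f h.1 h.2.1 fun s hs => p.coord_of_notMem hs

theorem FlipRel.mean_eq (f : G → ℝ) {p p' : 𝒢.CubePoint ℰ} (h : p.FlipRel p') :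
    mean f p.1.1 p.coord = mean f p'.1.1 p'.coord := by
  obtain ⟨T, hT, he, h⟩ := flipRel_iff.1 h
  rw [he]
  exact mean_flip f _ hT h

end CubePoint

namespace GlideComplex

/-- The mean value of a function on the vertices, as a function on the glide complex. -/
def mean (f : G → ℝ) : 𝒢.GlideComplex ℰ → ℝ :=
  Quot.lift (fun p => GlidingSystem.mean f p.1.1 p.coord) fun _ _ h =>
    h.elim (fun h => h.mean_eq f) fun h => h.mean_eq f

theorem continuous_mean (f : G → ℝ) : Continuous (mean f : 𝒢.GlideComplex ℰ → ℝ) :=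
  continuous_quot_lift _ (CubePoint.continuous_mean f)

theorem continuous_point : Continuous (point : 𝒢.CubePoint ℰ → 𝒢.GlideComplex ℰ) :=
  continuous_quot_mk

theorem isQuotientMap_point :
    Topology.IsQuotientMap (point : 𝒢.CubePoint ℰ → 𝒢.GlideComplex ℰ) :=
  isQuotientMap_quot_mk

theorem exists_point_eq (a : 𝒢.GlideComplex ℰ) : ∃ p : 𝒢.CubePoint ℰ, point p = a :=
  Quot.exists_rep a

theorem point_eq_of_faceRel {p p' : 𝒢.CubePoint ℰ} (h : p.FaceRel p') : point p = point p' :=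
  Quot.sound (Or.inl h)

theorem point_eq_of_flipRel {p p' : 𝒢.CubePoint ℰ} (h : p.FlipRel p') : point p = point p' :=
  Quot.sound (Or.inr h)

/-- The characteristic map of a cell. -/
def cellMap (q : {q : 𝒢.BasedCube // q.vertices ⊆ ℰ}) :
    C({s : G // s ∈ q.1.dirs} → unitInterval, 𝒢.GlideComplex ℰ) :=
  ⟨fun x => point ⟨q, x⟩, continuous_point.comp continuous_sigmaMk⟩

/-- A retraction of the glide complex onto a cell. -/
def retraction (q : {q : 𝒢.BasedCube // q.vertices ⊆ ℰ}) :
    C(𝒢.GlideComplex ℰ, {s : G // s ∈ q.1.dirs} → unitInterval) :=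
  -- The mean of an indicator already lies in `[0, 1]`; the projection merely supplies the codomain.
  ⟨fun a s => Set.projIcc 0 1 zero_le_one
    (mean (sideIndicator q.1 s) a),
    continuous_pi fun _ => continuous_projIcc.comp (continuous_mean _)⟩

theorem retraction_cellMap (q : {q : 𝒢.BasedCube // q.vertices ⊆ ℰ})
    (x : {s : G // s ∈ q.1.dirs} → unitInterval) : retraction q (cellMap q x) = x := by
  funext s
  have h : mean (sideIndicator q.1 s) (cellMap q x) = x s :=
    (mean_sideIndicator q.1 _ s.2).trans (CubePoint.coord_of_mem ⟨q, x⟩ s.2)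
  change Set.projIcc 0 1 zero_le_one _ = _
  rw [h, Set.projIcc_val]

theorem quotient_pi_subsingleton {ι : Type*} {x y : ι → unitInterval}
    (p p' : Path.Homotopic.Quotient x y) : p = p' := by
  rw [← Path.Homotopic.pi_proj p, ← Path.Homotopic.pi_proj p']
  congr 1
  funext i
  exact Subsingleton.elim _ _

/-- Two paths in a cell with the same endpoints are homotopic. -/
theorem homotopic_of_range_subset (q : {q : 𝒢.BasedCube // q.vertices ⊆ ℰ})
    {a b : 𝒢.GlideComplex ℰ} (γ γ' : Path a b) (hγ : Set.range γ ⊆ Set.range (cellMap q))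
    (hγ' : Set.range γ' ⊆ Set.range (cellMap q)) :
    Path.Homotopic.Quotient.mk γ = Path.Homotopic.Quotient.mk γ' := by
  have hr : ∀ c ∈ Set.range (cellMap q), cellMap q (retraction q c) = c := by
    rintro _ ⟨x, rfl⟩
    rw [retraction_cellMap]
  have ha := hr a (hγ ⟨0, γ.source⟩)
  have hb := hr b (hγ ⟨1, γ.target⟩)
  -- A path in the cell is the image of its own retraction, which is a path in the cube `I^S`, where
  -- endpoints determine the homotopy class.
  have key : ∀ δ : Path a b, Set.range δ ⊆ Set.range (cellMap q) →
      δ = ((δ.map (retraction q).continuous).map (cellMap q).continuous).cast ha.symm hb.symm := by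
    intro δ hδ
    ext t
    exact (hr _ (hδ ⟨t, rfl⟩)).symm
  rw [key γ hγ, key γ' hγ', Path.Homotopic.Quotient.mk_cast, Path.Homotopic.Quotient.mk_cast,
    Path.Homotopic.Quotient.mk_map _ (cellMap q), Path.Homotopic.Quotient.mk_map _ (cellMap q),
    quotient_pi_subsingleton (.mk (γ.map (retraction q).continuous))
      (.mk (γ'.map (retraction q).continuous))]

end GlideComplex

end Complex

end GlidingSystem

/-! ### Closed cells of cubes and paths in them. -/

namespace GlidingSystem

section Cells

open scoped Classical symmDiff

variable {G : Type*} [Group G] {𝒢 : GlidingSystem G} {ℰ : Set G}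

namespace CubePoint

/-- The point of a geometric cube with coordinates given by a function. -/
def ofCoord (q : {q : 𝒢.BasedCube // q.vertices ⊆ ℰ}) (x : G → unitInterval) : 𝒢.CubePoint ℰ :=
  ⟨q, fun s => x s⟩

theorem coord_ofCoord (q : {q : 𝒢.BasedCube // q.vertices ⊆ ℰ}) (x : G → unitInterval) {s : G}
    (hs : s ∈ q.1.dirs) : (ofCoord q x).coord s = x s :=
  (ofCoord q x).coord_of_mem hs

theorem exists_eq_ofCoord (p : 𝒢.CubePoint ℰ) : ∃ x, p = ofCoord p.1 x := by
  refine ⟨fun s => if h : s ∈ p.1.1.dirs then p.2 ⟨s, h⟩ else 0, ?_⟩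
  obtain ⟨q, x⟩ := p
  unfold ofCoord
  congr 1
  funext s
  simp [s.2]

theorem vertices_flip_subset {q : 𝒢.BasedCube} (hq : q.vertices ⊆ ℰ) {T : Finset G}
    (hT : T ⊆ q.dirs) : (q.flip T hT).vertices ⊆ ℰ := (q.vertices_flip T hT).trans_subset hq

theorem exists_flipRel_left (q : {q : 𝒢.BasedCube // q.vertices ⊆ ℰ}) (x : G → unitInterval)
    {T : Finset G} (hT : T ⊆ q.1.dirs) : ∃ y, (ofCoord q x).FlipRel
      (ofCoord ⟨q.1.flip T hT, vertices_flip_subset q.2 hT⟩ y) := by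
  -- `y u` is computed from the coordinate at the only `s` with `flipMap T s = u`; the value `0` off
  -- the flipped directions is never read.
  let y : G → unitInterval := fun u => if h : ∃ s ∈ q.1.dirs, flipMap T s = u then
    (if h.choose ∈ T then unitInterval.symm (x h.choose) else x h.choose) else 0
  refine ⟨y, flipRel_iff.2 ⟨T, hT, rfl, fun s hs => ?_⟩⟩
  replace hs : s ∈ q.1.dirs := hs
  rw [coord_ofCoord _ _ (Finset.mem_image_of_mem _ hs), coord_ofCoord _ _ hs]
  have h : ∃ s' ∈ q.1.dirs, flipMap T s' = flipMap T s := ⟨s, hs, rfl⟩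
  have h' : h.choose = s := q.1.indep.injOn_flipMap T h.choose_spec.1 hs h.choose_spec.2
  have hy : y (flipMap T s) = if s ∈ T then unitInterval.symm (x s) else x s := by
    conv_rhs => rw [← h']
    exact dif_pos h
  rw [hy]
  split_ifs <;> simp

theorem exists_flipRel_right (q : {q : 𝒢.BasedCube // q.vertices ⊆ ℰ}) {T : Finset G}
    (hT : T ⊆ q.1.dirs) (y : G → unitInterval) : ∃ x, (ofCoord q x).FlipRel
      (ofCoord ⟨q.1.flip T hT, vertices_flip_subset q.2 hT⟩ y) := by
  refine ⟨fun s => if s ∈ T then unitInterval.symm (y (flipMap T s)) else y (flipMap T s),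
    flipRel_iff.2 ⟨T, hT, rfl, fun s hs => ?_⟩⟩
  replace hs : s ∈ q.1.dirs := hs
  rw [coord_ofCoord _ _ (Finset.mem_image_of_mem _ hs), coord_ofCoord _ _ hs]
  split_ifs <;> simp

end CubePoint

namespace GlideComplex

open CubePoint

/-- The image of a geometric cube in the glide complex. -/
def baseCell (ℰ : Set G) (q : 𝒢.BasedCube) : Set (𝒢.GlideComplex ℰ) :=
  {a | ∃ (h : q.vertices ⊆ ℰ) (x : G → unitInterval), point (ofCoord ⟨q, h⟩ x) = a}

theorem baseCell_flip (q : 𝒢.BasedCube) {T : Finset G} (hT : T ⊆ q.dirs) :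
    baseCell ℰ (q.flip T hT) = baseCell ℰ q := by
  ext a
  constructor
  · rintro ⟨h, y, rfl⟩
    have h' : q.vertices ⊆ ℰ := (q.vertices_flip T hT).symm.trans_subset h
    obtain ⟨x, hx⟩ := exists_flipRel_right ⟨q, h'⟩ hT y
    exact ⟨h', x, point_eq_of_flipRel hx⟩
  · rintro ⟨h, x, rfl⟩
    obtain ⟨y, hy⟩ := exists_flipRel_left ⟨q, h⟩ x hT
    exact ⟨_, y, (point_eq_of_flipRel hy).symm⟩

theorem baseCell_eq_of_toCube_eq {q q' : 𝒢.BasedCube} (h : q.toCube = q'.toCube) :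
    baseCell ℰ q = baseCell ℰ q' := by
  refine congrArg (Quot.lift (fun q : 𝒢.BasedCube => baseCell ℰ q) ?_) h
  rintro q q' ⟨T, h⟩
  obtain ⟨hT, rfl⟩ := h.eq_flip
  exact (baseCell_flip q hT).symm

theorem baseCell_eq_range {q : 𝒢.BasedCube} (h : q.vertices ⊆ ℰ) :
    baseCell ℰ q = Set.range (cellMap ⟨q, h⟩) := by
  ext a
  constructor
  · rintro ⟨_, x, rfl⟩
    exact ⟨fun s => x s, rfl⟩
  · rintro ⟨x, rfl⟩
    obtain ⟨y, hy⟩ := exists_eq_ofCoord (⟨⟨q, h⟩, x⟩ : 𝒢.CubePoint ℰ)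
    exact ⟨h, y, congrArg point hy.symm⟩

/-- All representatives of a cube have the same image, so a single characteristic map covers the
closed cell. -/
theorem cell_toCube (q : 𝒢.BasedCube) : q.toCube.cell ℰ = baseCell ℰ q := by
  ext a
  constructor
  · rintro ⟨p, hp, rfl⟩
    rw [← baseCell_eq_of_toCube_eq hp]
    obtain ⟨x, hx⟩ := exists_eq_ofCoord p
    exact ⟨p.1.2, x, congrArg point hx.symm⟩
  · rintro ⟨h, x, rfl⟩
    exact ⟨_, rfl, rfl⟩

theorem baseCell_mono {q q' : 𝒢.BasedCube} (hb : q.base = q'.base) (hS : q.dirs ⊆ q'.dirs)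
    (h : q'.vertices ⊆ ℰ) : baseCell ℰ q ⊆ baseCell ℰ q' := by
  rintro _ ⟨hq, x, rfl⟩
  refine ⟨h, fun s => if s ∈ q.dirs then x s else 0, (point_eq_of_faceRel ?_).symm⟩
  refine FaceRel.of_coord hb hS fun s hs => ?_
  replace hs : s ∈ q'.dirs := hs
  rw [coord_ofCoord ⟨q', h⟩ _ hs]
  split_ifs with hsq
  · rw [coord_ofCoord ⟨q, hq⟩ _ hsq]
  · rw [coord_of_notMem _ hsq]
    rfl

theorem cell_mono {Q Q' : 𝒢.Cube} (h : Q.IsFace Q') (hQ' : Q'.IsIn ℰ) :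
    Q.cell ℰ ⊆ Q'.cell ℰ := by
  obtain ⟨q, q', rfl, rfl, hb, hS⟩ := h
  rw [cell_toCube, cell_toCube]
  rw [Cube.IsIn, q'.vertices_toCube] at hQ'
  exact baseCell_mono hb hS hQ'

theorem homotopic_of_range_subset_cell {Q : 𝒢.Cube} (hQ : Q.IsIn ℰ) {a b : 𝒢.GlideComplex ℰ}
    (γ γ' : Path a b) (hγ : Set.range γ ⊆ Q.cell ℰ) (hγ' : Set.range γ' ⊆ Q.cell ℰ) :
    Path.Homotopic.Quotient.mk γ = Path.Homotopic.Quotient.mk γ' := by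
  obtain ⟨q, rfl⟩ := Q.exists_rep
  rw [Cube.IsIn, q.vertices_toCube] at hQ
  rw [cell_toCube, baseCell_eq_range hQ] at hγ hγ'
  exact homotopic_of_range_subset _ γ γ' hγ hγ'

theorem exists_path_of_mem_cell {Q : 𝒢.Cube} (hQ : Q.IsIn ℰ) {a b : 𝒢.GlideComplex ℰ}
    (ha : a ∈ Q.cell ℰ) (hb : b ∈ Q.cell ℰ) : ∃ γ : Path a b, Set.range γ ⊆ Q.cell ℰ := by
  obtain ⟨q, rfl⟩ := Q.exists_rep
  rw [Cube.IsIn, q.vertices_toCube] at hQ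
  rw [cell_toCube, baseCell_eq_range hQ] at ha hb ⊢
  obtain ⟨x, rfl⟩ := ha
  obtain ⟨y, rfl⟩ := hb
  let p : Path x y := Path.pi fun s => PathConnectedSpace.somePath (x s) (y s)
  refine ⟨p.map (cellMap ⟨q, hQ⟩).continuous, ?_⟩
  rintro _ ⟨t, rfl⟩
  exact ⟨p t, rfl⟩

end GlideComplex

/-! ### Contraction of the open stars of the vertices -/

/-- The coordinates of the vertex `A` of a based cube. -/
def vertexCoord (A : G) (q : 𝒢.BasedCube) (s : G) : unitInterval :=
  if ∃ T, T ⊆ q.dirs ∧ s ∈ T ∧ q.vtx T = A then 1 else 0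

theorem vertexCoord_vtx (q : 𝒢.BasedCube) {T : Finset G} (hT : T ⊆ q.dirs) (s : G) :
    vertexCoord (q.vtx T) q s = if s ∈ T then 1 else 0 := by
  refine if_congr ⟨?_, fun h => ⟨T, hT, h, rfl⟩⟩ rfl rfl
  rintro ⟨U, hU, hs, h⟩
  rwa [← q.vtx_injective hU hT h]

theorem vertexCoord_flip (q : 𝒢.BasedCube) {T W : Finset G} (hT : T ⊆ q.dirs) (hW : W ⊆ q.dirs)
    {s : G} (hs : s ∈ q.dirs) : vertexCoord (q.vtx W) (q.flip T hT) (flipMap T s) =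
      if s ∈ T then unitInterval.symm (vertexCoord (q.vtx W) q s)
        else vertexCoord (q.vtx W) q s := by
  rw [vertexCoord_vtx q hW, ← q.vtx_flip hT hW,
    vertexCoord_vtx _ (Finset.image_subset_image (symmDiff_subset hT hW))]
  have h : flipMap T s ∈ (W ∆ T).image (flipMap T) ↔ s ∈ W ∆ T := by
    refine ⟨fun h => ?_, Finset.mem_image_of_mem _⟩
    obtain ⟨u, hu, hus⟩ := Finset.mem_image.1 h
    rwa [← q.indep.injOn_flipMap T (symmDiff_subset hT hW hu) hs hus]
  simp only [h, Finset.mem_symmDiff]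
  by_cases h1 : s ∈ T <;> by_cases h2 : s ∈ W <;> simp [h1, h2]

/-- Flipping along the `T` with `[T]`-vertex `A` moves the base to `A` and all coordinates to `0`;
the face with no directions is then the `0`-cell. -/
theorem zeroCell_eq_point {A : ℰ} {q : 𝒢.BasedCube} (hq : q.vertices ⊆ ℰ)
    (hA : (A : G) ∈ q.vertices) :
    𝒢.zeroCell A = GlideComplex.point (CubePoint.ofCoord ⟨q, hq⟩ (vertexCoord A q)) := by
  obtain ⟨T, hT, hA⟩ := q.mem_vertices.1 hA
  have h₁ : (CubePoint.ofCoord ⟨q, hq⟩ (vertexCoord A q)).FlipRel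
      (CubePoint.ofCoord ⟨q.flip T hT, CubePoint.vertices_flip_subset hq hT⟩ fun _ => 0) := by
    refine CubePoint.flipRel_iff.2 ⟨T, hT, rfl, fun s hs => ?_⟩
    replace hs : s ∈ q.dirs := hs
    rw [CubePoint.coord_ofCoord _ _ (Finset.mem_image_of_mem _ hs),
      CubePoint.coord_ofCoord _ _ hs, ← hA, vertexCoord_vtx q hT]
    split_ifs <;> simp
  rw [GlideComplex.point_eq_of_flipRel h₁]
  refine GlideComplex.point_eq_of_faceRel (CubePoint.FaceRel.of_coord hA.symm
    (Finset.empty_subset _) fun s hs => ?_)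
  replace hs : s ∈ (q.flip T hT).dirs := hs
  rw [CubePoint.coord_ofCoord _ _ hs, CubePoint.coord_of_notMem _ (Finset.notMem_empty s)]
  rfl

theorem zeroCell_mem_cell {A : ℰ} {Q : 𝒢.Cube} (hQ : Q.IsIn ℰ) (hA : (A : G) ∈ Q.vertices) :
    𝒢.zeroCell A ∈ Q.cell ℰ := by
  obtain ⟨q, rfl⟩ := Q.exists_rep
  rw [Cube.IsIn, q.vertices_toCube] at hQ
  rw [q.vertices_toCube] at hA
  rw [GlideComplex.cell_toCube]
  exact ⟨hQ, _, (zeroCell_eq_point hQ hA).symm⟩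

/-- The point that divides a segment of the unit interval in a given proportion. -/
def lerp (a b t : unitInterval) : unitInterval :=
  ⟨(1 - t) * a + t * b, by
    have h := convex_Icc (0 : ℝ) 1 a.2 b.2 (sub_nonneg.2 t.2.2) t.2.1 (by ring)
    simpa using h⟩

theorem _root_.Continuous.lerp {X : Type*} [TopologicalSpace X] {a b t : X → unitInterval}
    (ha : Continuous a) (hb : Continuous b) (ht : Continuous t) :
    Continuous fun x => lerp (a x) (b x) (t x) := by
  unfold GlidingSystem.lerp
  fun_prop

theorem coe_lerp (a b t : unitInterval) : (lerp a b t : ℝ) = (1 - t) * a + t * b := rfl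

theorem lerp_zero (a b : unitInterval) : lerp a b 0 = a := Subtype.ext (by simp [coe_lerp])

theorem lerp_one (a b : unitInterval) : lerp a b 1 = b := Subtype.ext (by simp [coe_lerp])

namespace CubePoint

/-- Moves a point of a geometric cube towards the vertex `A`. -/
def contract (A : G) (p : 𝒢.CubePoint ℰ) (t : unitInterval) : 𝒢.CubePoint ℰ :=
  ⟨p.1, fun s => lerp (p.2 s) (vertexCoord A p.1.1 s) t⟩

theorem continuous_contract (A : G) :
    Continuous fun x : 𝒢.CubePoint ℰ × unitInterval => contract A x.1 x.2 := by
  rw [← (Homeomorph.sigmaProdDistrib).symm.comp_continuous_iff']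
  refine continuous_sigma fun q => ?_
  have h : ∀ s : {s : G // s ∈ q.1.dirs}, Continuous
      fun x : ({s : G // s ∈ q.1.dirs} → unitInterval) × unitInterval =>
        lerp (x.1 s) (vertexCoord A q.1 s) x.2 := fun s =>
    ((continuous_apply s).comp continuous_fst).lerp continuous_const continuous_snd
  exact (continuous_sigmaMk (σ := fun q : {q : 𝒢.BasedCube // q.vertices ⊆ ℰ} =>
    {s : G // s ∈ q.1.dirs} → unitInterval)).comp (continuous_pi h)

theorem coord_contract (A : G) (p : 𝒢.CubePoint ℰ) (t : unitInterval) {s : G}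
    (hs : s ∈ p.1.1.dirs) : (contract A p t).coord s =
      (1 - t) * p.coord s + t * vertexCoord A p.1.1 s := by
  rw [(contract A p t).coord_of_mem hs, p.coord_of_mem hs]
  rfl

/-- Needs `A` to be a vertex of the smaller cube: only then do its coordinates vanish in the
additional directions, so that the contraction stays in the face. -/
theorem FaceRel.contract {A : G} {p p' : 𝒢.CubePoint ℰ} (h : p.FaceRel p')
    (hA : A ∈ p.1.1.vertices) (t : unitInterval) :
    (contract A p t).FaceRel (contract A p' t) := by
  refine FaceRel.of_coord h.1 h.2.1 fun s hs => ?_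
  obtain ⟨T, hT, rfl⟩ := p.1.1.mem_vertices.1 hA
  have hv : p.1.1.vtx T = p'.1.1.vtx T := by rw [BasedCube.vtx, BasedCube.vtx, h.1]
  rw [coord_contract _ p' t hs, ← h.coord_eq, hv, vertexCoord_vtx p'.1.1 (hT.trans h.2.1)]
  by_cases hs' : s ∈ p.1.1.dirs
  · rw [coord_contract _ p t hs', ← hv, vertexCoord_vtx p.1.1 hT]
  · rw [coord_of_notMem _ hs', coord_of_notMem (CubePoint.contract _ p t) hs',
      if_neg fun h => hs' (hT h)]
    simp

theorem FlipRel.contract {A : G} {p p' : 𝒢.CubePoint ℰ} (h : p.FlipRel p')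
    (hA : A ∈ p.1.1.vertices) (t : unitInterval) :
    (contract A p t).FlipRel (contract A p' t) := by
  obtain ⟨T, hT, he, h⟩ := flipRel_iff.1 h
  refine flipRel_iff.2 ⟨T, hT, he, fun s hs => ?_⟩
  obtain ⟨W, hW, rfl⟩ := p.1.1.mem_vertices.1 hA
  have hs' : flipMap T s ∈ p'.1.1.dirs := by
    rw [he]
    exact Finset.mem_image_of_mem _ hs
  rw [coord_contract _ p' t hs', coord_contract _ p t hs, h s hs, he,
    vertexCoord_flip p.1.1 hT hW hs]
  split_ifs
  · rw [unitInterval.coe_symm_eq]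
    ring
  · rfl

end CubePoint

end Cells

end GlidingSystem

/-! ### Open stars of vertices as a radial cover, and the presentation. -/

namespace GlidingSystem

section Stars

open scoped Classical

variable {G : Type*} [Group G] {𝒢 : GlidingSystem G} {ℰ : Set G}

/-- The indicator function of an element of `G`. -/
def vertexIndicator (A B : G) : ℝ := if B = A then 1 else 0

omit [Group G] in
theorem weight_pos_iff {S T : Finset G} (x : G → ℝ) (h₀ : ∀ s, 0 ≤ x s) (h₁ : ∀ s, x s ≤ 1)
    (hT : T ⊆ S) :
    0 < weight S x T ↔ ∀ s ∈ S, 0 < if s ∈ T then x s else 1 - x s := by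
  rw [weight_eq_prod x hT]
  refine ⟨fun h s hs => ?_, Finset.prod_pos⟩
  refine lt_of_le_of_ne ?_ (Finset.prod_ne_zero_iff.1 h.ne' s hs).symm
  split_ifs
  exacts [h₀ s, sub_nonneg.2 (h₁ s)]

namespace GlideComplex

variable (𝒢 ℰ) in
/-- The open star of a vertex. -/
def star (A : G) : Set (𝒢.GlideComplex ℰ) := {a | 0 < mean (vertexIndicator A) a}

theorem isOpen_star (A : G) : IsOpen (star 𝒢 ℰ A) :=
  isOpen_lt continuous_const (continuous_mean _)

/-- Distinct subsets give distinct vertices of a cube, so the mean of the indicator of a vertex is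
its weight, a product of nonnegative factors. -/
theorem point_mem_star_iff {A : G} {p : 𝒢.CubePoint ℰ} : point p ∈ star 𝒢 ℰ A ↔
    ∃ T ⊆ p.1.1.dirs, p.1.1.vtx T = A ∧
      ∀ s ∈ p.1.1.dirs, 0 < if s ∈ T then p.coord s else 1 - p.coord s := by
  change 0 < GlidingSystem.mean (vertexIndicator A) p.1.1 p.coord ↔ _
  constructor
  · intro h
    obtain ⟨T, hT, h'⟩ := Finset.exists_ne_zero_of_sum_ne_zero h.ne'
    have hT := Finset.mem_powerset.1 hT
    have hA : p.1.1.vtx T = A := by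
      by_contra hA
      exact h' (mul_eq_zero_of_right _ (if_neg hA))
    refine ⟨T, hT, hA, ?_⟩
    subst hA
    rw [show GlidingSystem.mean (vertexIndicator (p.1.1.vtx T)) p.1.1 p.coord = _ from
      mean_single p.1.1 p.coord hT] at h
    exact (weight_pos_iff p.coord p.coord_nonneg p.coord_le_one hT).1 h
  · rintro ⟨T, hT, rfl, h⟩
    rw [show GlidingSystem.mean (vertexIndicator (p.1.1.vtx T)) p.1.1 p.coord = _ from
      mean_single p.1.1 p.coord hT]
    exact (weight_pos_iff p.coord p.coord_nonneg p.coord_le_one hT).2 h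

theorem mem_vertices_of_mem_star {A : G} {p : 𝒢.CubePoint ℰ} (h : point p ∈ star 𝒢 ℰ A) :
    A ∈ p.1.1.vertices := by
  obtain ⟨T, hT, hA, _⟩ := point_mem_star_iff.1 h
  exact p.1.1.mem_vertices.2 ⟨T, hT, hA⟩

theorem exists_mem_star (a : 𝒢.GlideComplex ℰ) : ∃ A : ℰ, a ∈ star 𝒢 ℰ (A : G) := by
  obtain ⟨p, rfl⟩ := exists_point_eq a
  have h := sum_weight p.1.1.dirs p.coord
  obtain ⟨T, hT, h'⟩ := Finset.exists_ne_zero_of_sum_ne_zero (h.trans_ne one_ne_zero)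
  have hT := Finset.mem_powerset.1 hT
  refine ⟨⟨p.1.1.vtx T, p.1.2 (p.1.1.mem_vertices.2 ⟨T, hT, rfl⟩)⟩,
    point_mem_star_iff.2 ⟨T, hT, rfl, ?_⟩⟩
  rw [← weight_pos_iff p.coord p.coord_nonneg p.coord_le_one hT]
  refine lt_of_le_of_ne ?_ h'.symm
  exact mul_nonneg (Finset.prod_nonneg fun s _ => p.coord_nonneg s)
    (Finset.prod_nonneg fun s _ => sub_nonneg.2 (p.coord_le_one s))

theorem zeroCell_mem_star (A : ℰ) : 𝒢.zeroCell A ∈ star 𝒢 ℰ (A : G) :=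
  point_mem_star_iff.2 ⟨∅, Finset.empty_subset _, BasedCube.vtx_empty _,
    fun s hs => absurd hs (Finset.notMem_empty s)⟩

/-- Moves the points of the open star of `A` towards `A`. -/
def contract (A : G) (t : unitInterval) : 𝒢.GlideComplex ℰ → 𝒢.GlideComplex ℰ :=
  -- Membership in the star forces `A` to be a vertex of every cube representing the point, as
  -- compatibility with the gluing requires. Off the star the map is the identity, a default value.
  Quot.lift (fun p => if point p ∈ star 𝒢 ℰ A then point (CubePoint.contract A p t) else point p)
    (by
      intro p p' h
      have hp : point p = point p' := Quot.sound h
      rw [hp]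
      split_ifs with hA
      · have hA' := mem_vertices_of_mem_star (hp ▸ hA)
        exact h.elim (fun h => point_eq_of_faceRel (h.contract hA' t))
          fun h => point_eq_of_flipRel (h.contract hA' t)
      · rfl)

theorem contract_point {A : G} {p : 𝒢.CubePoint ℰ} (h : point p ∈ star 𝒢 ℰ A)
    (t : unitInterval) : contract A t (point p) = point (CubePoint.contract A p t) :=
  if_pos h

theorem contract_zero {A : G} {a : 𝒢.GlideComplex ℰ} (h : a ∈ star 𝒢 ℰ A) :
    contract A 0 a = a := by
  obtain ⟨p, rfl⟩ := exists_point_eq a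
  rw [contract_point h]
  unfold CubePoint.contract
  simp only [lerp_zero]

theorem contract_one {A : ℰ} {a : 𝒢.GlideComplex ℰ} (h : a ∈ star 𝒢 ℰ (A : G)) :
    contract (A : G) 1 a = 𝒢.zeroCell A := by
  obtain ⟨p, rfl⟩ := exists_point_eq a
  rw [contract_point h, zeroCell_eq_point p.1.2 (mem_vertices_of_mem_star h)]
  unfold CubePoint.contract CubePoint.ofCoord
  simp only [lerp_one]

theorem contract_mem_star {A : G} {a : 𝒢.GlideComplex ℰ} (h : a ∈ star 𝒢 ℰ A)
    (t : unitInterval) : contract A t a ∈ star 𝒢 ℰ A := by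
  obtain ⟨p, rfl⟩ := exists_point_eq a
  rw [contract_point h]
  obtain ⟨T, hT, hA, h⟩ := point_mem_star_iff.1 h
  refine point_mem_star_iff.2 ⟨T, hT, hA, fun s hs => ?_⟩
  replace hs : s ∈ p.1.1.dirs := hs
  have hs' := h s hs
  rw [CubePoint.coord_contract _ _ _ hs, ← hA, vertexCoord_vtx _ hT]
  rcases t with ⟨t, ht0, ht1⟩
  split_ifs at hs' ⊢
  · simp only [Set.Icc.coe_one]
    rcases ht0.eq_or_lt with h | h
    · subst h; simpa
    · have := mul_nonneg (sub_nonneg.2 ht1) hs'.le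
      linarith
  · simp only [Set.Icc.coe_zero]
    have := mul_nonneg ht0 (p.coord_nonneg s)
    linarith

/-- The gluing map stays a quotient map when restricted over an open set and multiplied by the
locally compact interval, so continuity can be checked on the cubes. -/
theorem continuous_contract (A : G) :
    Continuous fun x : star 𝒢 ℰ A × unitInterval => contract A x.2 (x.1 : 𝒢.GlideComplex ℰ) := by
  have hq := (isQuotientMap_point (𝒢 := 𝒢) (ℰ := ℰ)).restrictPreimage_isOpen (isOpen_star A)
  refine hq.continuous_lift_prod_left
    (g := fun x : star 𝒢 ℰ A × unitInterval => contract A x.2 (x.1 : 𝒢.GlideComplex ℰ)) ?_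
  have h : ∀ x : (point ⁻¹' star 𝒢 ℰ A) × unitInterval,
      contract A x.2 (point x.1.1) = point (CubePoint.contract A x.1.1 x.2) :=
    fun x => contract_point x.1.2 x.2
  have h' : Continuous fun x : (point ⁻¹' star 𝒢 ℰ A) × unitInterval =>
      point (CubePoint.contract A x.1.1 x.2) :=
    continuous_point.comp ((CubePoint.continuous_contract A).comp
      ((continuous_subtype_val.comp continuous_fst).prodMk continuous_snd))
  exact h'.congr fun x => (h x).symm

/-- The path from a point of the open star of `A` to `A` along the contraction. -/
def ray (A : ℰ) (a : 𝒢.GlideComplex ℰ) (h : a ∈ star 𝒢 ℰ (A : G)) : Path a (𝒢.zeroCell A) where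
  toFun t := contract (A : G) t a
  continuous_toFun := (continuous_contract (A : G)).comp
    (Continuous.prodMk_right (⟨a, h⟩ : star 𝒢 ℰ (A : G)))
  source' := contract_zero h
  target' := contract_one h

theorem range_ray_subset {A : ℰ} {p : 𝒢.CubePoint ℰ} (h : point p ∈ star 𝒢 ℰ (A : G)) :
    Set.range (ray A _ h) ⊆ p.1.1.toCube.cell ℰ := by
  rintro _ ⟨t, rfl⟩
  exact ⟨CubePoint.contract A p t, rfl, (contract_point h t).symm⟩

theorem mk_trans_mk_ray (A : ℰ) {a b : 𝒢.GlideComplex ℰ} (ha : a ∈ star 𝒢 ℰ (A : G))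
    (hb : b ∈ star 𝒢 ℰ (A : G)) (γ : Path a b) (hγ : ∀ t, γ t ∈ star 𝒢 ℰ (A : G)) :
    (Path.Homotopic.Quotient.mk γ).trans (.mk (ray A b hb)) = .mk (ray A a ha) := by
  -- The square with bottom `γ`, vertical sides the rays and constant top: its two boundary paths
  -- from `(0, 0)` to `(1, 1)` give the two sides of the identity.
  let F : C(unitInterval × unitInterval, 𝒢.GlideComplex ℰ) :=
    ⟨fun x => contract (A : G) x.2 (γ x.1), (continuous_contract (A : G)).comp
      (((γ.continuous.comp continuous_fst).subtype_mk fun x => hγ x.1).prodMk continuous_snd)⟩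
  let I : Path (0 : unitInterval) 1 := ⟨⟨_root_.id, continuous_id⟩, rfl, rfl⟩
  let p₁ : Path ((0, 0) : unitInterval × unitInterval) (1, 1) :=
    (I.prod (Path.refl 0)).trans ((Path.refl 1).prod I)
  let p₂ : Path ((0, 0) : unitInterval × unitInterval) (1, 1) :=
    ((Path.refl 0).prod I).trans (I.prod (Path.refl 1))
  have h₀ : a = F (0, 0) := by
    change a = contract (A : G) 0 (γ 0)
    rw [γ.source, contract_zero ha]
  have h₁ : 𝒢.zeroCell A = F (1, 1) := by
    change _ = contract (A : G) 1 (γ 1)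
    rw [γ.target, contract_one hb]
  have h : Path.Homotopic.Quotient.mk ((p₁.map F.continuous).cast h₀ h₁) =
      Path.Homotopic.Quotient.mk ((p₂.map F.continuous).cast h₀ h₁) := by
    rw [Path.Homotopic.Quotient.mk_cast, Path.Homotopic.Quotient.mk_cast,
      Path.Homotopic.Quotient.mk_map _ F, Path.Homotopic.Quotient.mk_map _ F,
      Subsingleton.elim (Path.Homotopic.Quotient.mk p₁) (Path.Homotopic.Quotient.mk p₂)]
  have e₁ : (p₁.map F.continuous).cast h₀ h₁ = γ.trans (ray A b hb) := by
    ext t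
    simp only [p₁, Path.map_trans, Path.cast_coe, Path.trans_apply]
    split_ifs
    · exact contract_zero (hγ _)
    · change contract (A : G) _ (γ 1) = contract (A : G) _ b
      rw [γ.target]
      rfl
  have e₂ : (p₂.map F.continuous).cast h₀ h₁ = (ray A a ha).trans (Path.refl _) := by
    ext t
    simp only [p₂, Path.map_trans, Path.cast_coe, Path.trans_apply]
    split_ifs
    · change contract (A : G) _ (γ 0) = contract (A : G) _ a
      rw [γ.source]
      rfl
    · exact contract_one (hγ _)
  rw [e₁, e₂, Path.Homotopic.Quotient.mk_trans, Path.Homotopic.Quotient.mk_trans,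
    Path.Homotopic.Quotient.mk_refl, Path.Homotopic.Quotient.trans_refl] at h
  exact h

variable (𝒢 ℰ) in
/-- The cover of the glide complex by the open stars of the vertices. -/
def starCover : RadialCover (𝒢.GlideComplex ℰ) ℰ where
  U A := star 𝒢 ℰ (A : G)
  isOpen A := isOpen_star (A : G)
  cover := exists_mem_star
  center := 𝒢.zeroCell
  center_mem := zeroCell_mem_star
  ray := ray
  ray_mem _ _ h t := contract_mem_star h t
  path_trans_ray A _ _ ha hb γ hγ := mk_trans_mk_ray A ha hb γ hγ

theorem inCommonCube_of_mem_star {A B C : ℰ} {a : 𝒢.GlideComplex ℰ}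
    (hA : a ∈ star 𝒢 ℰ (A : G)) (hB : a ∈ star 𝒢 ℰ (B : G)) (hC : a ∈ star 𝒢 ℰ (C : G)) :
    𝒢.InCommonCube ℰ A B C := by
  obtain ⟨p, rfl⟩ := exists_point_eq a
  refine ⟨p.1.1.toCube, ?_, ?_⟩
  · rw [Cube.IsIn, p.1.1.vertices_toCube]
    exact p.1.2
  · rw [p.1.1.vertices_toCube]
    exact ⟨mem_vertices_of_mem_star hA, mem_vertices_of_mem_star hB, mem_vertices_of_mem_star hC⟩

/-- The center of a cube lies in the stars of all its vertices. -/
theorem star_inter_nonempty {A B : G} {Q : 𝒢.Cube} (hQ : Q.IsIn ℰ) (hA : A ∈ Q.vertices)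
    (hB : B ∈ Q.vertices) : (star 𝒢 ℰ A ∩ star 𝒢 ℰ B).Nonempty := by
  obtain ⟨q, rfl⟩ := Q.exists_rep
  rw [Cube.IsIn, q.vertices_toCube] at hQ
  rw [q.vertices_toCube] at hA hB
  let p : 𝒢.CubePoint ℰ := CubePoint.ofCoord ⟨q, hQ⟩ fun _ => ⟨1 / 2, by norm_num, by norm_num⟩
  have h : ∀ A ∈ q.vertices, point p ∈ star 𝒢 ℰ A := by
    intro A hA
    obtain ⟨T, hT, hA⟩ := q.mem_vertices.1 hA
    refine point_mem_star_iff.2 ⟨T, hT, hA, fun s hs => ?_⟩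
    rw [CubePoint.coord_ofCoord ⟨q, hQ⟩ _ hs]
    split_ifs <;> norm_num
  exact ⟨point p, h A hA, h B hB⟩

end GlideComplex

/-- A single vertex is a hull of itself. -/
theorem exists_isHull_self {A : G} (hA : A ∈ ℰ) : ∃ Q : 𝒢.Cube, Q.IsHull ℰ {A, A} := by
  let q : 𝒢.BasedCube := ⟨A, ∅, 𝒢.isCubic_empty⟩
  refine ⟨q.toCube, ?_, ?_, fun Q' _ hQ' => ?_⟩
  · rw [Cube.IsIn, q.vertices_toCube]
    exact 𝒢.vertices_empty_subset ⟨A, hA⟩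
  · rw [q.vertices_toCube, Set.pair_eq_singleton, Set.singleton_subset_iff, q.mem_vertices]
    exact ⟨∅, Finset.empty_subset _, q.vtx_empty⟩
  · obtain ⟨q', rfl⟩ := Q'.exists_rep
    rw [q'.vertices_toCube] at hQ'
    obtain ⟨q'', h, hb⟩ := q'.exists_base_eq (hQ' (Set.mem_insert A _))
    exact ⟨q, q'', rfl, h, hb.symm, Finset.empty_subset _⟩

set_option maxHeartbeats 2000000 in
/-- If all pairs in `ℰ` have hulls, then the groupoid of the glide complex is presented by the
triangles in the cubes. -/
theorem isPresentedBy_inCommonCube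
    (hull : ∀ A ∈ ℰ, ∀ B ∈ ℰ, A ≠ B → ∃ Q : 𝒢.Cube, Q.IsHull ℰ {A, B}) :
    𝒢.IsPresentedBy ℰ (𝒢.InCommonCube ℰ) := by
  have hull' : ∀ A B : ℰ, ∃ Q : 𝒢.Cube, Q.IsHull ℰ {(A : G), (B : G)} := by
    intro A B
    by_cases h : (A : G) = B
    · rw [← h]
      exact exists_isHull_self A.2
    · exact hull A A.2 B B.2 h
  choose Q hQ using hull'
  have hl : ∀ A B, (A : G) ∈ (Q A B).vertices := fun A B => (hQ A B).2.1 (Set.mem_insert _ _)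
  have hr : ∀ A B, (B : G) ∈ (Q A B).vertices := fun A B =>
    (hQ A B).2.1 (Set.mem_insert_of_mem _ rfl)
  have hface : ∀ (A B : ℰ) (Q' : 𝒢.Cube), Q'.IsIn ℰ → (A : G) ∈ Q'.vertices →
      (B : G) ∈ Q'.vertices → (Q A B).cell ℰ ⊆ Q'.cell ℰ := fun A B Q' hin hA hB =>
    GlideComplex.cell_mono ((hQ A B).2.2 Q' hin (Set.insert_subset hA
      (Set.singleton_subset_iff.2 hB))) hin
  have hpath := fun A B => GlideComplex.exists_path_of_mem_cell (hQ A B).1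
    (zeroCell_mem_cell (hQ A B).1 (hl A B)) (zeroCell_mem_cell (hQ A B).1 (hr A B))
  choose γ hγ using hpath
  let z : ∀ A B : ℰ, (obj A : 𝒢.FundGroupoid ℰ) ⟶ obj B := fun A B => pathClass (γ A B)
  have hz : ∀ A B C : ℰ, 𝒢.InCommonCube ℰ A B C → z A C = z A B ≫ z B C := by
    -- The three hulls are faces of `Q'`, so the three chosen paths run in one cell.
    rintro A B C ⟨Q', hin, hA, hB, hC⟩
    refine InducedCategory.hom_ext ?_
    refine (GlideComplex.homotopic_of_range_subset_cell hin (γ A C) ((γ A B).trans (γ B C))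
      ((hγ A C).trans (hface A C Q' hin hA hC)) ?_).trans (Path.Homotopic.Quotient.mk_trans _ _)
    rw [Path.trans_range]
    exact Set.union_subset ((hγ A B).trans (hface A B Q' hin hA hB))
      ((hγ B C).trans (hface B C Q' hin hB hC))
  have hfull := (GlideComplex.starCover 𝒢 ℰ).full_and_faithful (R := 𝒢.InCommonCube ℰ) z hz
    (fun A B C ⟨_, ⟨hA, hB⟩, hC⟩ => GlideComplex.inCommonCube_of_mem_star hA hB hC)
    (fun A B => GlideComplex.star_inter_nonempty (hQ A B).1 (hl A B) (hr A B)) (by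
      -- A cube through `a` has both `A` and `B` as vertices, hence contains their hull; the two
      -- paths compared lie in its cell.
      intro A B a hA hB
      obtain ⟨p, rfl⟩ := GlideComplex.exists_point_eq a
      have hin : p.1.1.toCube.IsIn ℰ := by
        rw [Cube.IsIn, p.1.1.vertices_toCube]
        exact p.1.2
      have hA' := GlideComplex.mem_vertices_of_mem_star hA
      have hB' := GlideComplex.mem_vertices_of_mem_star hB
      refine (Path.Homotopic.Quotient.mk_trans _ _).symm.trans
        (GlideComplex.homotopic_of_range_subset_cell hin
          ((GlideComplex.ray A _ hA).trans (γ A B)) (GlideComplex.ray B _ hB) ?_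
          (GlideComplex.range_ray_subset hB))
      rw [Path.trans_range]
      refine Set.union_subset (GlideComplex.range_ray_subset hA)
        ((hγ A B).trans (hface A B _ hin ?_ ?_))
      all_goals rwa [p.1.1.vertices_toCube])
  refine ⟨z, hz, fun A B => ⟨Q A B, hQ A B, ⟨γ A B, hγ A B⟩, fun δ hδ => ?_⟩,
    TriangleGroupoid.lift_obj_bijective _ Function.bijective_id z hz, hfull⟩
  exact InducedCategory.hom_ext
    (GlideComplex.homotopic_of_range_subset_cell (hQ A B).1 (γ A B) δ (hγ A B) hδ)

end Stars

end GlidingSystem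

/-! ### Even cycles and dimer coverings -/

theorem PowerGroup.mem_mul {ι : Type*} {A B : PowerGroup ι} {e : ι} :
    e ∈ A * B ↔ (e ∈ A ∧ e ∉ B) ∨ (e ∈ B ∧ e ∉ A) := Iff.rfl

theorem PowerGroup.mul_self {ι : Type*} (A : PowerGroup ι) : A * A = 1 := mul_inv_cancel A

@[ext]
theorem PowerGroup.ext {ι : Type*} {A B : PowerGroup ι} (h : ∀ e, e ∈ A ↔ e ∈ B) : A = B :=
  Set.ext h

namespace Graph

open scoped Classical

open GlidingSystem

variable {α β : Type*} {Γ : Graph α β}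

theorem exists_inc (e : E(Γ)) : ∃ v, Γ.Inc e v := by
  obtain ⟨x, y, h⟩ := Γ.exists_isLink_of_mem_edgeSet e.2
  exact ⟨x, y, h⟩

/-- Two edges of an independent set of cycles with a common vertex belong to the same cycle. -/
theorem eq_of_touch {S : Finset (PowerGroup E(Γ))} (hS : Γ.cycleGliding.IsIndepSet S)
    {s t : PowerGroup E(Γ)} (hs : s ∈ S) (ht : t ∈ S) {e f : E(Γ)} (he : e ∈ s) (hf : f ∈ t)
    {v : α} (hev : Γ.Inc e v) (hfv : Γ.Inc f v) : s = t := by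
  by_contra hst
  exact (hS.2 hs ht hst).2.2 e he f hf ⟨v, hev, hfv⟩

theorem eq_of_mem {S : Finset (PowerGroup E(Γ))} (hS : Γ.cycleGliding.IsIndepSet S)
    {s t : PowerGroup E(Γ)} (hs : s ∈ S) (ht : t ∈ S) {e : E(Γ)} (he : e ∈ s) (he' : e ∈ t) :
    s = t := by
  obtain ⟨v, hv⟩ := exists_inc e
  exact eq_of_touch hS hs ht he he' hv hv

/-- Independent cycles share no edges, so their symmetric difference is their union. -/
theorem mem_br {S : Finset (PowerGroup E(Γ))} (hS : Γ.cycleGliding.IsIndepSet S) {e : E(Γ)} :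
    e ∈ Γ.cycleGliding.br S ↔ ∃ s ∈ S, e ∈ s := by
  induction S using Finset.induction_on with
  | empty =>
    rw [br_empty]
    exact ⟨fun h => absurd h (Set.notMem_empty e), fun ⟨s, hs, _⟩ => absurd hs (Finset.notMem_empty s)⟩
  | insert a S ha ih =>
    rw [hS.br_insert ha, PowerGroup.mem_mul, ih (hS.subset (Finset.subset_insert a S))]
    constructor
    · rintro (⟨h, _⟩ | ⟨⟨s, hs, h⟩, _⟩)
      exacts [⟨a, Finset.mem_insert_self a S, h⟩, ⟨s, Finset.mem_insert_of_mem hs, h⟩]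
    · rintro ⟨s, hs, h⟩
      rcases Finset.mem_insert.1 hs with rfl | hs'
      · refine Or.inl ⟨h, ?_⟩
        rintro ⟨t, ht, h'⟩
        exact ha (eq_of_mem hS hs (Finset.mem_insert_of_mem ht) h h' ▸ ht)
      · refine Or.inr ⟨⟨s, hs', h⟩, fun h' => ?_⟩
        exact ha (eq_of_mem hS hs (Finset.mem_insert_self a S) h h' ▸ hs')

theorem isCubic_of_isIndepSet {S : Finset (PowerGroup E(Γ))}
    (hS : Γ.cycleGliding.IsIndepSet S) : Γ.cycleGliding.IsCubic S := by
  have key : ∀ T₁ T₂, T₁ ⊆ S → T₂ ⊆ S → Γ.cycleGliding.br T₁ = Γ.cycleGliding.br T₂ →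
      T₁ ⊆ T₂ := by
    intro T₁ T₂ h₁ h₂ h t ht
    obtain ⟨e, he⟩ : ∃ e, e ∈ t := (hS.1 t (h₁ ht)).1.2.1
    have he' := (mem_br (hS.subset h₁)).2 ⟨t, ht, he⟩
    rw [h, mem_br (hS.subset h₂)] at he'
    obtain ⟨t', ht', he'⟩ := he'
    rwa [eq_of_mem hS (h₁ ht) (h₂ ht') he he']
  exact BasedCube.isCubic_of_br hS fun T₁ T₂ h₁ h₂ h =>
    (key T₁ T₂ h₁ h₂ h).antisymm (key T₂ T₁ h₂ h₁ h.symm)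

/-! #### Dimer coverings -/

/-- Being a dimer covering is tested at one vertex at a time, so the model `Y` may depend on `v`. -/
theorem mem_dimerCoverings_of_local {X : PowerGroup E(Γ)}
    (h : ∀ v ∈ V(Γ), ∃ Y ∈ Γ.dimerCoverings, ∀ f : E(Γ), Γ.Inc f v → (f ∈ X ↔ f ∈ Y)) :
    X ∈ Γ.dimerCoverings := by
  intro v hv
  obtain ⟨Y, hY, h⟩ := h v hv
  refine (existsUnique_congr fun f => ?_).2 (hY v hv)
  exact and_congr_left fun hf => h f hf

theorem dimerAt_mem (A : Γ.dimerCoverings) (v : α) (hv : v ∈ V(Γ)) :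
    dimerAt A v hv ∈ (A : PowerGroup E(Γ)) := (A.2 v hv).choose_spec.1.1

theorem dimerAt_inc (A : Γ.dimerCoverings) (v : α) (hv : v ∈ V(Γ)) :
    Γ.Inc (dimerAt A v hv) v := (A.2 v hv).choose_spec.1.2

theorem eq_dimerAt {A : Γ.dimerCoverings} {v : α} (hv : v ∈ V(Γ)) {e : E(Γ)}
    (he : e ∈ (A : PowerGroup E(Γ))) (hev : Γ.Inc e v) : e = dimerAt A v hv :=
  (A.2 v hv).choose_spec.2 e ⟨he, hev⟩

theorem mem_iff_of_dimerAt_eq {A B : Γ.dimerCoverings} {v : α} {hv : v ∈ V(Γ)}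
    (h : dimerAt A v hv = dimerAt B v hv) {f : E(Γ)} (hf : Γ.Inc f v) :
    f ∈ (A : PowerGroup E(Γ)) ↔ f ∈ (B : PowerGroup E(Γ)) := by
  constructor
  · intro h'
    rw [eq_dimerAt hv h' hf, h]
    exact dimerAt_mem B v hv
  · intro h'
    rw [eq_dimerAt hv h' hf, ← h]
    exact dimerAt_mem A v hv

/-- A cube is a cube of dimer coverings if its edges at one vertex have this property. -/
theorem br_mul_mem_dimerCoverings {S T : Finset (PowerGroup E(Γ))}
    (hS : Γ.cycleGliding.IsIndepSet S) {M : PowerGroup E(Γ)} (hM : M ∈ Γ.dimerCoverings)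
    (h : ∀ s ∈ S, s * M ∈ Γ.dimerCoverings) (hT : T ⊆ S) :
    Γ.cycleGliding.br T * M ∈ Γ.dimerCoverings := by
  refine mem_dimerCoverings_of_local fun v _ => ?_
  by_cases hv : ∃ t ∈ T, ∃ e ∈ t, Γ.Inc e v
  · obtain ⟨t, ht, e, he, hev⟩ := hv
    refine ⟨t * M, h t (hT ht), fun f hf => ?_⟩
    have h' : f ∈ Γ.cycleGliding.br T ↔ f ∈ t := by
      rw [mem_br (hS.subset hT)]
      refine ⟨?_, fun h => ⟨t, ht, h⟩⟩
      rintro ⟨t', ht', hf'⟩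
      rwa [eq_of_touch hS (hT ht) (hT ht') he hf' hev hf]
    rw [PowerGroup.mem_mul, PowerGroup.mem_mul, h']
  · refine ⟨M, hM, fun f hf => ?_⟩
    have h' : f ∉ Γ.cycleGliding.br T := by
      rw [mem_br (hS.subset hT)]
      rintro ⟨t, ht, hft⟩
      exact hv ⟨t, ht, f, hft, hf⟩
    simp [PowerGroup.mem_mul, h']

/-! #### Components of the symmetric difference of two dimer coverings -/

/-- Two edges in `D` have a common vertex. -/
def Near (D : PowerGroup E(Γ)) (e f : E(Γ)) : Prop :=
  e ∈ D ∧ f ∈ D ∧ ∃ v, Γ.Inc e v ∧ Γ.Inc f v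

theorem Near.symm {D : PowerGroup E(Γ)} {e f : E(Γ)} (h : Near D e f) : Near D f e :=
  let ⟨he, hf, v, hev, hfv⟩ := h
  ⟨hf, he, v, hfv, hev⟩

theorem reflTransGen_near_symm {D : PowerGroup E(Γ)} {e f : E(Γ)}
    (h : Relation.ReflTransGen (Near D) e f) : Relation.ReflTransGen (Near D) f e :=
  have : Std.Symm (Near D) := ⟨fun _ _ h => h.symm⟩
  Relation.ReflTransGen.stdSymm.symm _ _ h

/-- The connected component of an edge in a set of edges. -/
def comp (D : PowerGroup E(Γ)) (e : E(Γ)) : PowerGroup E(Γ) :=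
  (show Set E(Γ) from {f | Relation.ReflTransGen (Near D) e f})

theorem mem_comp {D : PowerGroup E(Γ)} {e f : E(Γ)} :
    f ∈ comp D e ↔ Relation.ReflTransGen (Near D) e f := Iff.rfl

theorem self_mem_comp (D : PowerGroup E(Γ)) (e : E(Γ)) : e ∈ comp D e :=
  Relation.ReflTransGen.refl

theorem comp_subset {D : PowerGroup E(Γ)} {e f : E(Γ)} (he : e ∈ D) (hf : f ∈ comp D e) :
    f ∈ D := by
  rcases Relation.ReflTransGen.cases_tail hf with h | ⟨_, _, h⟩
  exacts [h ▸ he, h.2.1]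

theorem comp_eq_of_mem {D : PowerGroup E(Γ)} {e f : E(Γ)} (h : f ∈ comp D e) :
    comp D e = comp D f := by
  ext g
  have h' : Relation.ReflTransGen (Near D) f e := reflTransGen_near_symm h
  exact ⟨fun hg => h'.trans hg, fun hg => Relation.ReflTransGen.trans h hg⟩

theorem mem_comp_of_touch {D : PowerGroup E(Γ)} {e f g : E(Γ)} (he : e ∈ D) (hf : f ∈ comp D e)
    (hg : g ∈ D) {v : α} (hfv : Γ.Inc f v) (hgv : Γ.Inc g v) : g ∈ comp D e :=
  Relation.ReflTransGen.tail hf ⟨comp_subset he hf, hg, v, hfv, hgv⟩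

theorem reflTransGen_near_comp {D : PowerGroup E(Γ)} {e f : E(Γ)} (hf : f ∈ comp D e) :
    Relation.ReflTransGen (Near (comp D e)) e f := by
  have hf' := mem_comp.1 hf
  induction hf' with
  | refl => exact .refl
  | tail h h' ih => exact (ih h).tail ⟨h, hf, h'.2.2⟩

variable [Finite E(Γ)]

/-- The set of connected components of a set of edges. -/
def comps (D : PowerGroup E(Γ)) : Finset (PowerGroup E(Γ)) :=
  ((Set.toFinite {e : E(Γ) | e ∈ D}).image (comp D)).toFinset

theorem mem_comps {D s : PowerGroup E(Γ)} : s ∈ comps D ↔ ∃ e ∈ D, comp D e = s := by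
  rw [comps, Set.Finite.mem_toFinset]
  rfl

variable (A B : Γ.dimerCoverings)

omit [Finite E(Γ)] in
/-- The edges at a vertex in the symmetric difference of two dimer coverings. -/
theorem mem_mul_iff_of_inc {v : α} (hv : v ∈ V(Γ)) {f : E(Γ)} (hf : Γ.Inc f v) :
    f ∈ (A * B : PowerGroup E(Γ)) ↔ dimerAt A v hv ≠ dimerAt B v hv ∧
      (f = dimerAt A v hv ∨ f = dimerAt B v hv) := by
  rw [PowerGroup.mem_mul]
  constructor
  · rintro (⟨hA, hB⟩ | ⟨hB, hA⟩)
    · have := eq_dimerAt hv hA hf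
      refine ⟨fun h => hB ?_, Or.inl this⟩
      rw [this, h]
      exact dimerAt_mem B v hv
    · have := eq_dimerAt hv hB hf
      refine ⟨fun h => hA ?_, Or.inr this⟩
      rw [this, ← h]
      exact dimerAt_mem A v hv
  · rintro ⟨h, rfl | rfl⟩
    · exact Or.inl ⟨dimerAt_mem A v hv, fun h' => h (eq_dimerAt hv h' hf)⟩
    · exact Or.inr ⟨dimerAt_mem B v hv, fun h' => h (eq_dimerAt hv h' hf).symm⟩

/-- At a vertex met by the component its edges are exactly `A_v` and `B_v`, which are distinct
there. -/
theorem comp_mul_isCyclicSet {e : E(Γ)} (he : e ∈ (A * B : PowerGroup E(Γ))) :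
    Γ.IsCyclicSet (comp (A * B : PowerGroup E(Γ)) e) := by
  refine ⟨Set.toFinite _, fun v hv => ?_⟩
  rcases Set.eq_empty_or_nonempty {f | f ∈ comp (A * B : PowerGroup E(Γ)) e ∧ Γ.Inc f v} with
    h | ⟨f, hf, hfv⟩
  · exact Or.inl h
  · right
    have hne := ((mem_mul_iff_of_inc A B hv hfv).1 (comp_subset he hf)).1
    refine Eq.trans (congrArg Set.ncard ?_) (Set.ncard_pair hne)
    ext g
    constructor
    · rintro ⟨hg, hgv⟩
      exact ((mem_mul_iff_of_inc A B hv hgv).1 (comp_subset he hg)).2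
    · intro hg
      have hgv : Γ.Inc g v := by
        rcases hg with rfl | rfl
        exacts [dimerAt_inc A v hv, dimerAt_inc B v hv]
      exact ⟨mem_comp_of_touch he hf ((mem_mul_iff_of_inc A B hv hgv).2 ⟨hne, hg⟩) hfv hgv, hgv⟩

omit [Finite E(Γ)] in
theorem ncard_inc [Γ.Loopless] (e : E(Γ)) : {v | Γ.Inc e v}.ncard = 2 := by
  obtain ⟨x, y, h⟩ := Γ.exists_isLink_of_mem_edgeSet e.2
  rw [← Set.ncard_pair h.ne]
  congr 1
  ext v
  exact ⟨fun hv => hv.eq_or_eq_of_isLink h, by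
    rintro (rfl | rfl)
    exacts [h.inc_left, h.inc_right]⟩

/-- In a component of the symmetric difference of two dimer coverings there are as many edges of
the one as of the other. -/
theorem ncard_comp_inter [Γ.Loopless] {e : E(Γ)} (he : e ∈ (A * B : PowerGroup E(Γ))) :
    {f | f ∈ comp (A * B : PowerGroup E(Γ)) e ∧ f ∈ (A : PowerGroup E(Γ))}.ncard =
      {f | f ∈ comp (A * B : PowerGroup E(Γ)) e ∧ f ∈ (B : PowerGroup E(Γ))}.ncard := by
  have hfin : ∀ f : E(Γ), {v | Γ.Inc f v}.Finite := fun f =>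
    Set.finite_of_ncard_ne_zero (by rw [ncard_inc]; norm_num)
  let c := comp (A * B : PowerGroup E(Γ)) e
  let t : E(Γ) → Finset α := fun f => (hfin f).toFinset
  have ht : ∀ f, (t f).card = 2 := fun f => by
    rw [← Set.ncard_eq_toFinset_card _ (hfin f), ncard_inc]
  have hmem : ∀ f v, v ∈ t f ↔ Γ.Inc f v := fun f v => (hfin f).mem_toFinset
  -- The edges of a dimer covering have disjoint pairs of endpoints, so they cover twice as many
  -- vertices as their number.
  have hcard : ∀ C : Γ.dimerCoverings,
      ((Set.toFinite {f | f ∈ c ∧ f ∈ (C : PowerGroup E(Γ))}).toFinset.biUnion t).card =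
        {f | f ∈ c ∧ f ∈ (C : PowerGroup E(Γ))}.ncard * 2 := by
    intro C
    rw [Finset.card_biUnion, Finset.sum_const_nat fun f _ => ht f,
      Set.ncard_eq_toFinset_card _ (Set.toFinite _)]
    intro f hf g hg hfg
    rw [Finset.mem_coe, Set.Finite.mem_toFinset] at hf hg
    refine Finset.disjoint_left.2 fun v hvf hvg => hfg ?_
    rw [hmem] at hvf hvg
    rw [eq_dimerAt hvf.vertex_mem hf.2 hvf, eq_dimerAt hvf.vertex_mem hg.2 hvg]
  -- Both coverings match precisely the vertices of the component.
  have hunion : (Set.toFinite {f | f ∈ c ∧ f ∈ (A : PowerGroup E(Γ))}).toFinset.biUnion t =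
      (Set.toFinite {f | f ∈ c ∧ f ∈ (B : PowerGroup E(Γ))}).toFinset.biUnion t := by
    ext v
    simp only [Finset.mem_biUnion, Set.Finite.mem_toFinset, hmem]
    constructor
    · rintro ⟨f, ⟨hf, _⟩, hfv⟩
      have hv := hfv.vertex_mem
      have hne := ((mem_mul_iff_of_inc A B hv hfv).1 (comp_subset he hf)).1
      have hB := dimerAt_inc B v hv
      exact ⟨_, ⟨mem_comp_of_touch he hf
        ((mem_mul_iff_of_inc A B hv hB).2 ⟨hne, Or.inr rfl⟩) hfv hB, dimerAt_mem B v hv⟩, hB⟩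
    · rintro ⟨f, ⟨hf, _⟩, hfv⟩
      have hv := hfv.vertex_mem
      have hne := ((mem_mul_iff_of_inc A B hv hfv).1 (comp_subset he hf)).1
      have hA := dimerAt_inc A v hv
      exact ⟨_, ⟨mem_comp_of_touch he hf
        ((mem_mul_iff_of_inc A B hv hA).2 ⟨hne, Or.inl rfl⟩) hfv hA, dimerAt_mem A v hv⟩, hA⟩
  have h := (hcard A).symm.trans ((congrArg Finset.card hunion).trans (hcard B))
  exact Nat.eq_of_mul_eq_mul_right two_pos h

theorem comp_mul_isEvenCycle [Γ.Loopless] {e : E(Γ)} (he : e ∈ (A * B : PowerGroup E(Γ))) :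
    Γ.IsEvenCycle (comp (A * B : PowerGroup E(Γ)) e) := by
  refine ⟨⟨comp_mul_isCyclicSet A B he, ⟨e, self_mem_comp _ e⟩, fun f hf g hg => ?_⟩, ?_⟩
  · change Relation.ReflTransGen (Near (comp (A * B : PowerGroup E(Γ)) e)) f g
    exact (reflTransGen_near_symm (reflTransGen_near_comp hf)).trans
      (reflTransGen_near_comp hg)
  · have h : (comp (A * B : PowerGroup E(Γ)) e : Set E(Γ)) =
        {f | f ∈ comp (A * B : PowerGroup E(Γ)) e ∧ f ∈ (A : PowerGroup E(Γ))} ∪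
        {f | f ∈ comp (A * B : PowerGroup E(Γ)) e ∧ f ∈ (B : PowerGroup E(Γ))} := by
      ext f
      constructor
      · intro hf
        rcases PowerGroup.mem_mul.1 (comp_subset he hf) with h | h
        exacts [Or.inl ⟨hf, h.1⟩, Or.inr ⟨hf, h.1⟩]
      · rintro (h | h) <;> exact h.1
    have hd : Disjoint
        {f | f ∈ comp (A * B : PowerGroup E(Γ)) e ∧ f ∈ (A : PowerGroup E(Γ))}
        {f | f ∈ comp (A * B : PowerGroup E(Γ)) e ∧ f ∈ (B : PowerGroup E(Γ))} := by
      refine Set.disjoint_left.2 fun f hA hB => ?_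
      rcases PowerGroup.mem_mul.1 (comp_subset he hA.1) with h | h
      exacts [h.2 hB.2, h.2 hA.2]
    refine Eq.subst (motive := fun s : Set E(Γ) => Even s.ncard) h.symm ?_
    rw [Set.ncard_union_eq hd (Set.toFinite _) (Set.toFinite _), ncard_comp_inter A B he]
    exact ⟨_, rfl⟩

theorem isEvenCycle_of_mem_comps [Γ.Loopless] {s : PowerGroup E(Γ)}
    (hs : s ∈ comps (A * B : PowerGroup E(Γ))) : Γ.IsEvenCycle s := by
  obtain ⟨e, he, rfl⟩ := mem_comps.1 hs
  exact comp_mul_isEvenCycle A B he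

omit A B in
theorem comps_eq_of_touch {D s t : PowerGroup E(Γ)} (hs : s ∈ comps D) (ht : t ∈ comps D)
    {e f : E(Γ)} (he : e ∈ s) (hf : f ∈ t) {v : α} (hev : Γ.Inc e v) (hfv : Γ.Inc f v) :
    s = t := by
  obtain ⟨a, ha, rfl⟩ := mem_comps.1 hs
  obtain ⟨b, hb, rfl⟩ := mem_comps.1 ht
  have h := mem_comp_of_touch ha he (comp_subset hb hf) hev hfv
  rw [comp_eq_of_mem h, comp_eq_of_mem hf]

theorem isIndepSet_comps [Γ.Loopless] :
    Γ.cycleGliding.IsIndepSet (comps (A * B : PowerGroup E(Γ))) := by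
  refine ⟨fun s hs => isEvenCycle_of_mem_comps A B hs, fun s hs t ht hst =>
    ⟨isEvenCycle_of_mem_comps A B hs, isEvenCycle_of_mem_comps A B ht, ?_⟩⟩
  rintro e he f hf ⟨v, hev, hfv⟩
  exact hst (comps_eq_of_touch hs ht he hf hev hfv)

omit A B in
theorem mem_iff_exists_mem_comps {D : PowerGroup E(Γ)} {e : E(Γ)} :
    e ∈ D ↔ ∃ s ∈ comps D, e ∈ s := by
  constructor
  · exact fun he => ⟨comp D e, mem_comps.2 ⟨e, he, rfl⟩, self_mem_comp D e⟩
  · rintro ⟨s, hs, he⟩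
    obtain ⟨a, ha, rfl⟩ := mem_comps.1 hs
    exact comp_subset ha he

theorem br_comps [Γ.Loopless] :
    Γ.cycleGliding.br (comps (A * B : PowerGroup E(Γ))) = A * B := by
  ext e
  rw [mem_br (isIndepSet_comps A B), mem_iff_exists_mem_comps]

/-- Multiplying by `s` replaces `A` by `B` at the vertices of `s` and changes nothing elsewhere. -/
theorem mul_mem_dimerCoverings {s : PowerGroup E(Γ)}
    (hs : s ∈ comps (A * B : PowerGroup E(Γ))) : s * A ∈ Γ.dimerCoverings := by
  obtain ⟨a, ha, rfl⟩ := mem_comps.1 hs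
  refine mem_dimerCoverings_of_local fun v _ => ?_
  by_cases hv : ∃ e ∈ comp (A * B : PowerGroup E(Γ)) a, Γ.Inc e v
  · obtain ⟨e, he, hev⟩ := hv
    refine ⟨B, B.2, fun f hf => ?_⟩
    have h : f ∈ comp (A * B : PowerGroup E(Γ)) a ↔ f ∈ (A * B : PowerGroup E(Γ)) :=
      ⟨comp_subset ha, fun h => mem_comp_of_touch ha he h hev hf⟩
    rw [PowerGroup.mem_mul, h, PowerGroup.mem_mul]
    tauto
  · refine ⟨A, A.2, fun f hf => ?_⟩
    have h : f ∉ comp (A * B : PowerGroup E(Γ)) a := fun h => hv ⟨f, h, hf⟩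
    simp [PowerGroup.mem_mul, h]

end Graph

namespace Graph

open scoped Classical

open GlidingSystem

variable {α β : Type*} {Γ : Graph α β}

/-! #### Hulls and flat triples of dimer coverings -/

theorem mul_mul_cancel_right {ι : Type*} (A B : PowerGroup ι) : A * B * B = A := by
  rw [mul_assoc, PowerGroup.mul_self, mul_one]

/-- The based cube given by an independent set of cycles and a dimer covering. -/
def dimerCube (M : PowerGroup E(Γ)) (S : Finset (PowerGroup E(Γ)))
    (hS : Γ.cycleGliding.IsIndepSet S) : Γ.cycleGliding.BasedCube :=
  ⟨M, S, isCubic_of_isIndepSet hS⟩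

theorem isIn_dimerCube {M : PowerGroup E(Γ)} {S : Finset (PowerGroup E(Γ))}
    (hS : Γ.cycleGliding.IsIndepSet S) (hM : M ∈ Γ.dimerCoverings)
    (h : ∀ s ∈ S, s * M ∈ Γ.dimerCoverings) :
    (dimerCube M S hS).toCube.IsIn Γ.dimerCoverings := by
  rw [Cube.IsIn, BasedCube.vertices_toCube]
  intro A hA
  obtain ⟨T, hT, rfl⟩ := (BasedCube.mem_vertices _).1 hA
  exact br_mul_mem_dimerCoverings hS hM h hT

theorem mem_vertices_dimerCube {M A : PowerGroup E(Γ)} {S T : Finset (PowerGroup E(Γ))}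
    (hS : Γ.cycleGliding.IsIndepSet S) (hT : T ⊆ S) (h : Γ.cycleGliding.br T = A * M) :
    A ∈ (dimerCube M S hS).toCube.vertices := by
  rw [BasedCube.vertices_toCube, BasedCube.mem_vertices]
  refine ⟨T, hT, ?_⟩
  rw [BasedCube.vtx, h]
  exact mul_mul_cancel_right A M

/-- The components of the product of an independent set of cycles are cycles of this set. -/
theorem comps_br_subset [Finite E(Γ)] {T : Finset (PowerGroup E(Γ))}
    (hT : Γ.cycleGliding.IsIndepSet T) : comps (Γ.cycleGliding.br T) ⊆ T := by
  intro s hs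
  obtain ⟨e, he, rfl⟩ := mem_comps.1 hs
  obtain ⟨t, ht, het⟩ := (mem_br hT).1 he
  -- A cycle is connected and no other cycle of the set touches it.
  have key : t = comp (Γ.cycleGliding.br T) e := by
    ext f
    constructor
    · intro hf
      refine mem_comp.2 (Relation.ReflTransGen.lift id ?_ _ _ ((hT.1 t ht).1.2.2 e het f hf))
      rintro a b ⟨ha, hb, h⟩
      exact ⟨(mem_br hT).2 ⟨t, ht, ha⟩, (mem_br hT).2 ⟨t, ht, hb⟩, h⟩
    · intro hf
      replace hf := mem_comp.1 hf
      induction hf with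
      | refl => exact het
      | tail _ h ih =>
        obtain ⟨_, hc, v, hbv, hcv⟩ := h
        obtain ⟨t', ht', hct⟩ := (mem_br hT).1 hc
        rwa [eq_of_touch hT ht ht' ih hct hbv hcv]
  rwa [← key]

/-- The hull is based at `A` in the directions of the components of `A * B`. In any other cube with
these vertices, rebased at `A`, one has `A * B = [T]` for a set `T` of directions, and the
components of `[T]` belong to `T`. -/
theorem exists_isHull [Γ.Loopless] [Finite E(Γ)] (A B : Γ.dimerCoverings) :
    ∃ Q : Γ.cycleGliding.Cube, Q.IsHull Γ.dimerCoverings {A.1, B.1} := by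
  have hS := isIndepSet_comps A B
  refine ⟨(dimerCube A.1 _ hS).toCube,
    isIn_dimerCube hS A.2 fun s hs => mul_mem_dimerCoverings A B hs, ?_, ?_⟩
  · refine Set.insert_subset ?_ (Set.singleton_subset_iff.2 ?_)
    · exact mem_vertices_dimerCube hS (Finset.empty_subset _)
        (br_empty.trans (PowerGroup.mul_self _).symm)
    · exact mem_vertices_dimerCube hS subset_rfl ((br_comps A B).trans (mul_comm _ _))
  · intro Q' _ hQ'
    obtain ⟨q, rfl⟩ := Q'.exists_rep
    rw [q.vertices_toCube] at hQ'
    obtain ⟨q', h, hb⟩ := q.exists_base_eq (hQ' (Set.mem_insert _ _))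
    have hB := hQ' (Set.mem_insert_of_mem _ rfl)
    rw [← BasedCube.vertices_eq_of_toCube_eq h] at hB
    obtain ⟨T, hT, hB⟩ := q'.mem_vertices.1 hB
    refine ⟨_, q', rfl, h, hb.symm, Finset.Subset.trans ?_ hT⟩
    have hbr : Γ.cycleGliding.br T = A.1 * B.1 := by
      rw [← hB, BasedCube.vtx, hb, mul_comm, mul_mul_cancel_right]
    change comps (A.1 * B.1) ⊆ T
    rw [← hbr]
    exact comps_br_subset (q'.indep.subset hT)

/-- At most one cycle `s` of the cube passes through `v`, so the edge at `v` depends only on whether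
`s` belongs to the subset labelling the vertex of the cube; of three truth values two agree. -/
theorem isFlat_of_inCommonCube {A B C : Γ.dimerCoverings}
    (h : Γ.cycleGliding.InCommonCube Γ.dimerCoverings A B C) : IsFlat A B C := by
  obtain ⟨Q, hQ, hA, hB, hC⟩ := h
  obtain ⟨q, rfl⟩ := Q.exists_rep
  rw [q.vertices_toCube] at hA hB hC
  obtain ⟨T₁, h₁, hA⟩ := q.mem_vertices.1 hA
  obtain ⟨T₂, h₂, hB⟩ := q.mem_vertices.1 hB
  obtain ⟨T₃, h₃, hC⟩ := q.mem_vertices.1 hC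
  intro v hv
  have hS := q.indep
  have key : ∀ (X Y : Γ.dimerCoverings) (T U : Finset (PowerGroup E(Γ))), T ⊆ q.dirs →
      U ⊆ q.dirs → q.vtx T = X.1 → q.vtx U = Y.1 →
      (∀ s ∈ q.dirs, ∀ e ∈ s, Γ.Inc e v → (s ∈ T ↔ s ∈ U)) →
      dimerAt X v hv = dimerAt Y v hv := by
    intro X Y T U hT hU hX hY h
    have hX' := dimerAt_mem X v hv
    have hXv := dimerAt_inc X v hv
    refine eq_dimerAt hv ?_ hXv
    rw [← hX, BasedCube.vtx, PowerGroup.mem_mul, mem_br (hS.subset hT)] at hX'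
    rw [← hY, BasedCube.vtx, PowerGroup.mem_mul, mem_br (hS.subset hU)]
    have h' : (∃ s ∈ T, dimerAt X v hv ∈ s) ↔ ∃ s ∈ U, dimerAt X v hv ∈ s :=
      ⟨fun ⟨s, hs, hs'⟩ => ⟨s, (h s (hT hs) _ hs' hXv).1 hs, hs'⟩,
        fun ⟨s, hs, hs'⟩ => ⟨s, (h s (hU hs) _ hs' hXv).2 hs, hs'⟩⟩
    rwa [← h']
  by_cases hs : ∃ s ∈ q.dirs, ∃ e ∈ s, Γ.Inc e v
  · obtain ⟨s, hs, e, he, hev⟩ := hs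
    have huniq : ∀ T U : Finset (PowerGroup E(Γ)), (s ∈ T ↔ s ∈ U) →
        ∀ s' ∈ q.dirs, ∀ e ∈ s', Γ.Inc e v → (s' ∈ T ↔ s' ∈ U) := by
      intro T U h s' hs' f hf hfv
      rwa [← eq_of_touch hS hs hs' he hf hev hfv]
    by_cases h₁₂ : s ∈ T₁ ↔ s ∈ T₂
    · exact Or.inl (key A B T₁ T₂ h₁ h₂ hA hB (huniq _ _ h₁₂))
    · by_cases h₁₃ : s ∈ T₁ ↔ s ∈ T₃
      · exact Or.inr (Or.inl (key A C T₁ T₃ h₁ h₃ hA hC (huniq _ _ h₁₃)))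
      · exact Or.inr (Or.inr (key B C T₂ T₃ h₂ h₃ hB hC (huniq _ _ (by tauto))))
  · exact Or.inl (key A B T₁ T₂ h₁ h₂ hA hB fun s hs' e he hev => absurd ⟨s, hs', e, he, hev⟩ hs)

/-- The edges that belong to at least two of three dimer coverings. -/
def majority (A B C : PowerGroup E(Γ)) : PowerGroup E(Γ) :=
  (show Set E(Γ) from {e | (e ∈ A ∧ e ∈ B) ∨ (e ∈ A ∧ e ∈ C) ∨ (e ∈ B ∧ e ∈ C)})

theorem mem_majority {A B C : PowerGroup E(Γ)} {e : E(Γ)} : e ∈ majority A B C ↔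
    (e ∈ A ∧ e ∈ B) ∨ (e ∈ A ∧ e ∈ C) ∨ (e ∈ B ∧ e ∈ C) := Iff.rfl

/-- Where two of the three coverings agree, the majority agrees with them. -/
theorem majority_mem_dimerCoverings {A B C : Γ.dimerCoverings} (h : IsFlat A B C) :
    majority A.1 B.1 C.1 ∈ Γ.dimerCoverings := by
  refine mem_dimerCoverings_of_local fun v hv => ?_
  rcases h v hv with h | h | h
  · refine ⟨A.1, A.2, fun f hf => ?_⟩
    have := mem_iff_of_dimerAt_eq h hf
    rw [mem_majority]
    tauto
  · refine ⟨A.1, A.2, fun f hf => ?_⟩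
    have := mem_iff_of_dimerAt_eq h hf
    rw [mem_majority]
    tauto
  · refine ⟨B.1, B.2, fun f hf => ?_⟩
    have := mem_iff_of_dimerAt_eq h hf
    rw [mem_majority]
    tauto

theorem majority_comm_left (A B C : PowerGroup E(Γ)) : majority A B C = majority B A C := by
  ext e
  simp only [mem_majority]
  tauto

theorem majority_comm_right (A B C : PowerGroup E(Γ)) : majority A B C = majority A C B := by
  ext e
  simp only [mem_majority]
  tauto

theorem IsFlat.swap_left {A B C : Γ.dimerCoverings} (h : IsFlat A B C) : IsFlat B A C :=
  fun v hv => (h v hv).elim (fun h => Or.inl h.symm) fun h => Or.inr h.symm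

theorem IsFlat.swap_right {A B C : Γ.dimerCoverings} (h : IsFlat A B C) : IsFlat A C B :=
  fun v hv => by
    rcases h v hv with h | h | h
    exacts [Or.inr (Or.inl h), Or.inl h, Or.inr (Or.inr h.symm)]

/-- At each vertex two of the three coverings agree with the majority, so at most one of them
differs from it there. -/
theorem not_touch_majority {A B C : Γ.dimerCoverings} (h : IsFlat A B C) {e f : E(Γ)}
    (he : e ∈ A.1 * majority A.1 B.1 C.1) (hf : f ∈ B.1 * majority A.1 B.1 C.1) {v : α}
    (hev : Γ.Inc e v) (hfv : Γ.Inc f v) : False := by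
  rw [PowerGroup.mem_mul, mem_majority] at he hf
  rcases h v hev.vertex_mem with h | h | h
  all_goals
    have h₁ := mem_iff_of_dimerAt_eq h hev
    have h₂ := mem_iff_of_dimerAt_eq h hfv
    tauto

theorem isIndepSet_union [Γ.Loopless] {S T : Finset (PowerGroup E(Γ))}
    (hS : Γ.cycleGliding.IsIndepSet S) (hT : Γ.cycleGliding.IsIndepSet T)
    (h : ∀ s ∈ S, ∀ t ∈ T, ∀ e ∈ s, ∀ f ∈ t, ∀ v, Γ.Inc e v → Γ.Inc f v → False) :
    Γ.cycleGliding.IsIndepSet (S ∪ T) := by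
  have key : ∀ s ∈ S, ∀ t ∈ T, Γ.cycleGliding.Indep s t := fun s hs t ht =>
    ⟨hS.1 s hs, hT.1 t ht, fun e he f hf ⟨v, hev, hfv⟩ => h s hs t ht e he f hf v hev hfv⟩
  refine ⟨fun s hs => (Finset.mem_union.1 hs).elim (hS.1 s) (hT.1 s), fun s hs t ht hst => ?_⟩
  rcases Finset.mem_union.1 hs with hs | hs <;> rcases Finset.mem_union.1 ht with ht | ht
  exacts [hS.2 hs ht hst, key s hs t ht, Γ.cycleGliding.symm (key t ht s hs), hT.2 hs ht hst]

/-- With `M` the majority, `A * M`, `B * M` and `C * M` have pairwise no common vertices. Their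
components together form one independent set, and the cube based at `M` in these directions has `A`,
`B` and `C` as vertices. -/
theorem inCommonCube_of_isFlat [Γ.Loopless] [Finite E(Γ)] {A B C : Γ.dimerCoverings}
    (h : IsFlat A B C) : Γ.cycleGliding.InCommonCube Γ.dimerCoverings A B C := by
  let M : Γ.dimerCoverings := ⟨majority A.1 B.1 C.1, majority_mem_dimerCoverings h⟩
  have hAB : ∀ {e f : E(Γ)} {v : α}, e ∈ A.1 * M.1 → f ∈ B.1 * M.1 → Γ.Inc e v → Γ.Inc f v →
      False := fun he hf => not_touch_majority h he hf
  have hAC : ∀ {e f : E(Γ)} {v : α}, e ∈ A.1 * M.1 → f ∈ C.1 * M.1 → Γ.Inc e v → Γ.Inc f v →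
      False := by
    intro e f v he hf
    have hM : M.1 = majority A.1 C.1 B.1 := majority_comm_right _ _ _
    rw [hM] at he hf
    exact not_touch_majority h.swap_right he hf
  have hBC : ∀ {e f : E(Γ)} {v : α}, e ∈ B.1 * M.1 → f ∈ C.1 * M.1 → Γ.Inc e v → Γ.Inc f v →
      False := by
    intro e f v he hf
    have hM : M.1 = majority B.1 C.1 A.1 :=
      (majority_comm_left _ _ _).trans (majority_comm_right _ _ _)
    rw [hM] at he hf
    exact not_touch_majority h.swap_left.swap_right he hf
  have hsub : ∀ {X : Γ.dimerCoverings} {s}, s ∈ comps (X.1 * M.1) → ∀ {e}, e ∈ s →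
      e ∈ X.1 * M.1 := fun hs _ he => mem_iff_exists_mem_comps.2 ⟨_, hs, he⟩
  have hmul : ∀ {X : Γ.dimerCoverings} {s}, s ∈ comps (X.1 * M.1) → s * M.1 ∈ Γ.dimerCoverings := by
    intro X s hs
    rw [mul_comm X.1 M.1] at hs
    exact mul_mem_dimerCoverings M X hs
  have hS₁ := isIndepSet_union (isIndepSet_comps A M) (isIndepSet_comps B M)
    fun s hs t ht e he f hf v => hAB (hsub hs he) (hsub ht hf)
  have hS := isIndepSet_union hS₁ (isIndepSet_comps C M) fun s hs t ht e he f hf v hev hfv =>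
    (Finset.mem_union.1 hs).elim (fun hs => hAC (hsub hs he) (hsub ht hf) hev hfv)
      fun hs => hBC (hsub hs he) (hsub ht hf) hev hfv
  refine ⟨(dimerCube M.1 _ hS).toCube, isIn_dimerCube hS M.2 fun s hs => ?_, ?_, ?_, ?_⟩
  · rcases Finset.mem_union.1 hs with hs | hs
    · exact (Finset.mem_union.1 hs).elim hmul hmul
    · exact hmul hs
  · exact mem_vertices_dimerCube hS
      (Finset.subset_union_left.trans Finset.subset_union_left) (br_comps A M)
  · exact mem_vertices_dimerCube hS
      (Finset.subset_union_right.trans Finset.subset_union_left) (br_comps B M)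
  · exact mem_vertices_dimerCube hS Finset.subset_union_right (br_comps C M)

/-- The dimer groupoid is presented by the flat triangles. -/
theorem isPresentedBy_isFlat [Γ.Loopless] [Finite E(Γ)] :
    Γ.cycleGliding.IsPresentedBy Γ.dimerCoverings IsFlat := by
  have h : (IsFlat : Γ.dimerCoverings → Γ.dimerCoverings → Γ.dimerCoverings → Prop) =
      Γ.cycleGliding.InCommonCube Γ.dimerCoverings := by
    funext A B C
    exact propext ⟨inCommonCube_of_isFlat, isFlat_of_inCommonCube⟩
  rw [h]
  exact isPresentedBy_inCommonCube fun A hA B hB _ => exists_isHull ⟨A, hA⟩ ⟨B, hB⟩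

end Graph

end

theorem mainTheorem10 :
    (∀ {G : Type*} [Group G] (𝒢 : GlidingSystem G) (ℰ : Set G),
      (∀ A ∈ ℰ, ∀ B ∈ ℰ, A ≠ B → ∃ Q : 𝒢.Cube, Q.IsHull ℰ {A, B}) →
        𝒢.IsPresentedBy ℰ (𝒢.InCommonCube ℰ)) ∧
    (∀ {α β : Type*} (Γ : Graph α β) [Γ.Loopless],
      Γ.vertexSet.Finite → Γ.edgeSet.Finite →
        Γ.cycleGliding.IsPresentedBy Γ.dimerCoverings Graph.IsFlat) := by
  refine ⟨fun 𝒢 ℰ h => GlidingSystem.isPresentedBy_inCommonCube h, fun Γ _ _ hE => ?_⟩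
  have := hE.to_subtype
  exact Graph.isPresentedBy_isFlat
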